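/- **Setting.** Let $K\ge 2$ (arms), $T\ge 2$ (rounds), $d$ (dimension), let $\mathcal X$ be a measurable space with a probability distribution $\mathcal G$, let $\mathcal Z,\Theta\subseteq\mathbb R^d$, and let $\phi:[K]\times\mathcal X\to\mathcal Z$ be a known feature map, measurable in $x$. Let $\mathcal P_K$ be the probability simplex in $\mathbb R^K$. For $p:\mathcal X\to\mathcal P_K$ put $\Sigma(p)=\mathbb E_{X_0\sim\mathcal G,\,a\sim p(X_0)}[\phi(a,X_0)\phi(a,X_0)^\top]$. *Protocol (adversarial regime).* In round $t=1,\dots,T$, nature chooses $\theta_t\in\Theta$ as an arbitrary function of the information $\mathcal F_{t-1}$ available before the round (which contains $(X_s,A_s,\ell_s(A_s,X_s))_{s<t}$ and possibly private randomness of nature); a context $X_t\sim\mathcal G$ is drawn independently of $\mathcal F_{t-1}$; the learner draws $A_t\in[K]$ from $\pi_t(X_t)\in\mathcal P_K$ with fresh randomness (that is, conditionally on $\mathcal F_{t-1}$, $X_t$ and the noise, $A_t=a$ has probability $\pi_t(a\mid X_t)$), and observes $\ell_t(A_t,X_t)$, where $\ell_t(a,x)=\langle\phi(a,x),\theta_t\rangle+\varepsilon_t(a)$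 and $\mathbb E[\varepsilon_t(a)\mid X_t,\mathcal F_{t-1}]=0$. The losses are bounded: $|\langle z,\theta\rangle|\le 1$ for all $z\in\mathcal Z$, $\theta\in\Theta$, and almost surely $|\ell_t(a,x)|\le 1$ for all $t,a,x$. The regret is $$R_T=\sup_{\rho:\mathcal X\to[K]\text{ measurable}}\ \mathbb E\Big[\sum_{t=1}^T\{\ell_t(A_t,X_t)-\ell_t(\rho(X_t),X_t)\}\Big].$$ *Exploration policy.* There are $\lambda>0$ and a measurable $e^*:\mathcal X\to\mathcal P_K$ such that $\Sigma(e^*)$ is invertible and $z^\top\Sigma(e^*)^{-1}z\le 1/\lambda$ for all $z\in\mathcal Z$. *Algorithm (BoBW-RealFTRL).* Let $H(q)=\sum_a q(a)\log(1/q(a))$ and $\psi=-H$. The learner plays $\pi_t(x)=(1-\gamma_t)q_t(x)+\gamma_te^*(x)$ with $\gamma_t=\eta_t/\lambda$, where $q_1(x)=(1/K,\dots,1/K)$, and for $t\ge 2$ $$q_t(x)\in\operatorname*{argmin}_{q\in\mathcal P_K}\Big\{\sum_{s=1}^{t-1}\langle\widehat\ell_s(x),q\rangle+\frac1{\eta_t}\psi(q)\Big\},$$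 with $\widehat\ell_s(x)=(\langle\widehat\theta_s,\phi(a,x)\rangle)_{a\in[K]}$, $\widehat\theta_s=\Sigma(\pi_s)^{-1}\phi(A_s,X_s)\,\ell_s(A_s,X_s)$, and $$\frac1{\eta_1}=\sqrt{\frac{(\frac1\lambda+d)\log T}{\log K}},\qquad \frac1{\eta_{t+1}}=\frac1{\eta_t}+\frac1{\eta_1}\,\frac1{\sqrt{1+(\log K)^{-1}\sum_{s=1}^tH(q_s(X_s))}}.$$ Assume that $\gamma_1\le 1$ (that is, $\eta_1\le\lambda$). The sequence $\gamma_t$ is decreasing, so all the mixing weights are then at most $1$ and every $\pi_t(x)$ is a probability vector. **Theorem.** There is an absolute constant $C>0$ such that in this setting, for all $K,T,d,\lambda$, all context distributions, feature maps and exploration policies, and every adversarial choice of $(\theta_t)$ and noise, the supremum defining $R_T$ is finite and $$R_T\le C\,\log(KT)\sqrt{\Big(\frac1\lambda+d\Big)\,T\log T}.$$ -/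

import Mathlib

open MeasureTheory ProbabilityTheory

noncomputable section

namespace LinBandit

/-- The Shannon entropy `H(q) = ∑ₐ q(a) log (1 / q(a))`, with `0 log (1 / 0) = 0`. -/
def entropy {K : ℕ} (q : Fin K → ℝ) : ℝ :=
  ∑ a, q a * Real.log (1 / q a)

/-- The regularizer `ψ(q) = - ∑ₐ q(a) log (1 / q(a))`. -/
def regularizer {K : ℕ} (q : Fin K → ℝ) : ℝ :=
  -∑ a, q a * Real.log (1 / q a)

/-- The matrix `Σ(p) = E_{X₀ ∼ G, a ∼ p(X₀)} [φ(a, X₀) φ(a, X₀)ᵀ]`. -/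
def covMatrix {K d : ℕ} {𝒳 : Type*} [MeasurableSpace 𝒳] (G : Measure 𝒳)
    (φ : Fin K → 𝒳 → Fin d → ℝ) (p : 𝒳 → Fin K → ℝ) : Matrix (Fin d) (Fin d) ℝ :=
  Matrix.of fun i j => ∫ x, ∑ a, p x a * (φ a x i * φ a x j) ∂G

/-- `G` is a probability distribution of contexts, and the feature map `φ` is a measurable map
into the feature space `Z ⊆ ℝᵈ`. -/
structure IsContextModel {K d : ℕ} {𝒳 : Type*} [MeasurableSpace 𝒳] (G : Measure 𝒳)
    (φ : Fin K → 𝒳 → Fin d → ℝ) (Z : Set (Fin d → ℝ)) : Prop where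
  isProbabilityMeasure : IsProbabilityMeasure G
  measurable_feature : ∀ a, Measurable (φ a)
  feature_mem : ∀ a x, φ a x ∈ Z

/-- `e` is an exploration policy with constant `lam`: the symmetric matrix `Σ(e)` is nonsingular
(for this positive semidefinite matrix: positive definite), and `zᵀ Σ(e)⁻¹ z ≤ 1 / lam` for
every `z` in the feature space. -/
structure IsExplorationPolicy {K d : ℕ} {𝒳 : Type*} [MeasurableSpace 𝒳] (G : Measure 𝒳)
    (φ : Fin K → 𝒳 → Fin d → ℝ) (Z : Set (Fin d → ℝ)) (lam : ℝ) (e : 𝒳 → Fin K → ℝ) : Prop where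
  lam_pos : 0 < lam
  measurable_policy : ∀ a, Measurable fun x => e x a
  mem_simplex : ∀ x, e x ∈ stdSimplex ℝ (Fin K)
  posDef : (covMatrix G φ e).PosDef
  quadForm_le : ∀ z ∈ Z, z ⬝ᵥ ((covMatrix G φ e)⁻¹).mulVec z ≤ 1 / lam

/-- The raw data of one run of a `K`-armed bandit with `d`-dimensional features over `T` rounds:
the context distribution, the feature map, the constant `lam` and the exploration policy, and the
random contexts `X`, actions `A`, parameters `θ`, noises `ε`, and FTRL iterates `q`
(`q t ω x a` is `q_t(a ∣ x)` on the outcome `ω`). Rounds are numbered from `0`, so that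
round `t` here is the round `t + 1` of a numbering that starts from one. -/
structure Run (K d T : ℕ) (𝒳 Ω : Type*) [MeasurableSpace 𝒳] where
  G : Measure 𝒳
  φ : Fin K → 𝒳 → Fin d → ℝ
  lam : ℝ
  e : 𝒳 → Fin K → ℝ
  X : ℕ → Ω → 𝒳
  A : ℕ → Ω → Fin K
  θ : ℕ → Ω → Fin d → ℝ
  ε : ℕ → Ω → Fin K → ℝ
  q : ℕ → Ω → 𝒳 → Fin K → ℝ

namespace Run

variable {K d T : ℕ} {𝒳 Ω : Type*} [MeasurableSpace 𝒳] (R : Run K d T 𝒳 Ω)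

/-- The linear loss `ℓ_t(a, x) = ⟨φ(a, x), θ_t⟩ + ε_t(a)`. -/
def loss (t : ℕ) (ω : Ω) (a : Fin K) (x : 𝒳) : ℝ :=
  R.φ a x ⬝ᵥ R.θ t ω + R.ε t ω a

/-- The inverse of the initial learning rate. -/
def invEtaFirst : ℝ :=
  √((1 / R.lam + (d : ℝ)) * Real.log T / Real.log K)

/-- The inverses of the entropy-adaptive learning rates. -/
def invEta (ω : Ω) : ℕ → ℝ
  | 0 => R.invEtaFirst
  | t + 1 => invEta ω t + R.invEtaFirst * (1 /
      √(1 + (Real.log K)⁻¹ * ∑ s ∈ Finset.range (t + 1), entropy (R.q s ω (R.X s ω))))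

/-- The learning rate `η_t`. -/
def eta (t : ℕ) (ω : Ω) : ℝ := 1 / R.invEta ω t

/-- The mixing weight `γ_t = η_t / λ`. -/
def gamma (t : ℕ) (ω : Ω) : ℝ := R.eta t ω / R.lam

/-- The policy `π_t(x) = (1 - γ_t) q_t(x) + γ_t e(x)`. -/
def policy (t : ℕ) (ω : Ω) (x : 𝒳) (a : Fin K) : ℝ :=
  (1 - R.gamma t ω) * R.q t ω x a + R.gamma t ω * R.e x a

/-- `Σ_t = Σ(π_t)`. -/
def cov (t : ℕ) (ω : Ω) : Matrix (Fin d) (Fin d) ℝ :=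
  covMatrix R.G R.φ (R.policy t ω)

/-- The estimator `Σ_t⁻¹ φ(A_t, X_t) ℓ_t(A_t, X_t)` of `θ_t`. -/
def thetaHat (t : ℕ) (ω : Ω) : Fin d → ℝ :=
  (R.cov t ω)⁻¹.mulVec (R.loss t ω (R.A t ω) (R.X t ω) • R.φ (R.A t ω) (R.X t ω))

/-- The estimator of the loss of arm `a` at the context `x`. -/
def lossHat (t : ℕ) (ω : Ω) (x : 𝒳) (a : Fin K) : ℝ :=
  R.thetaHat t ω ⬝ᵥ R.φ a x

/-- The FTRL objective of round `t`. -/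
def objective (t : ℕ) (ω : Ω) (x : 𝒳) (p : Fin K → ℝ) : ℝ :=
  ∑ s ∈ Finset.range t, ∑ a, R.lossHat s ω x a * p a + 1 / R.eta t ω * regularizer p

/-- The iterates `q` are those of BoBW-RealFTRL: uniform in the first round, and a minimizer of
the FTRL objective over the probability simplex in each later round. -/
structure IsBoBWRealFTRL : Prop where
  first : ∀ ω x a, R.q 0 ω x a = 1 / (K : ℝ)
  mem_simplex : ∀ t, 0 < t → t < T → ∀ ω x, R.q t ω x ∈ stdSimplex ℝ (Fin K)
  isMinOn : ∀ t, 0 < t → t < T → ∀ ω x,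
    IsMinOn (R.objective t ω x) (stdSimplex ℝ (Fin K)) (R.q t ω x)

variable [mΩ : MeasurableSpace Ω]

/-- The interaction protocol in the adversarial regime. `ℱ t` is the information available
before round `t`; it contains the history `(X_s, A_s, ℓ_s(A_s, X_s))`, `s < t`, and may contain
private randomness of nature. The parameter `θ_t` is an arbitrary `Θ`-valued function of that
information; then the context `X_t` is drawn from `G` independently of it; the noise is centred
given that information and `X_t`; and the action is drawn from `π_t(X_t)` by fresh randomness. -/
structure IsAdversarial (μ : Measure Ω) (ℱ : Filtration ℕ mΩ) (Θ : Set (Fin d → ℝ)) : Prop where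
  measurable_noise : ∀ t < T, Measurable (R.ε t)
  adapted_context : ∀ t < T, Measurable[ℱ (t + 1)] (R.X t)
  adapted_action : ∀ t < T, Measurable[ℱ (t + 1)] (R.A t)
  adapted_loss : ∀ t < T, Measurable[ℱ (t + 1)] fun ω => R.loss t ω (R.A t ω) (R.X t ω)
  predictable_parameter : ∀ t < T, Measurable[ℱ t] (R.θ t)
  parameter_mem : ∀ t < T, ∀ ω, R.θ t ω ∈ Θ
  context_law : ∀ t < T, μ.map (R.X t) = R.G
  context_indep : ∀ t < T, Indep (MeasurableSpace.comap (R.X t) inferInstance) (ℱ t) μ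
  noise_centred : ∀ t < T, ∀ a,
    μ[fun ω => R.ε t ω a | ℱ t ⊔ MeasurableSpace.comap (R.X t) inferInstance] =ᵐ[μ] 0
  action_law : ∀ t < T, ∀ a,
    μ[Set.indicator {ω | R.A t ω = a} (fun _ => (1 : ℝ)) |
        ℱ t ⊔ MeasurableSpace.comap (R.X t) inferInstance
          ⊔ MeasurableSpace.comap (R.ε t) inferInstance]
      =ᵐ[μ] fun ω => R.policy t ω (R.X t ω) a

/-- Bounded losses: `|⟨z, θ⟩| ≤ 1` on `Z × Θ`, and almost surely `|ℓ_t(a, x)| ≤ 1` for all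
rounds, arms and contexts. -/
structure IsBounded (μ : Measure Ω) (Z Θ : Set (Fin d → ℝ)) : Prop where
  inner_le : ∀ z ∈ Z, ∀ ϑ ∈ Θ, |z ⬝ᵥ ϑ| ≤ 1
  loss_le : ∀ t < T, ∀ᵐ ω ∂μ, ∀ a x, |R.loss t ω a x| ≤ 1

/-- The expected excess loss over the comparator `ρ`. -/
def regretAgainst (μ : Measure Ω) (ρ : 𝒳 → Fin K) : ℝ :=
  ∫ ω, ∑ t ∈ Finset.range T,
    (R.loss t ω (R.A t ω) (R.X t ω) - R.loss t ω (ρ (R.X t ω)) (R.X t ω)) ∂μ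

/-- The regret: the supremum of the excess loss over all measurable maps from contexts to arms. -/
def regret (μ : Measure Ω) : ℝ :=
  ⨆ ρ : {ρ : 𝒳 → Fin K // Measurable ρ}, R.regretAgainst μ ρ

end Run

end LinBandit

end

/-! Write `b_t = 1/η_t`, `b_0` for the first of these, `M = 1/λ + d`, and `P_t` for the inverse of
the policy covariance. The argument is follow-the-regularized-leader run separately at every frozen
context `x`, integrated over `x`, and compared with the true regret in expectation.

The entropic minimizer is unique and is a Gibbs distribution (`eq_gibbs_of_isMinOn`). Hence the
iterate is an explicit measurable function of the context and of a finite-dimensional state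
(cumulative estimate, `b_t`, `θ_t`), which is known before the round (`measurable_param`). The fresh
context can then be integrated out by Fubini, the action and the noise by conditional expectation.

Three costs arise. Exploration: playing `π_t` instead of `q_t` costs at most `2γ_t = 2η_t/λ`
(`integral_excess_le`). Penalty: raising `b_t` to `b_{t+1}` costs `(b_{t+1} - b_t) H(q_{t+1}(x))`
(`freeEnergy_le_add_entropy`). Averaged over `x`, this entropy has the same mean as the entropy at
the context actually drawn (`integral_penalty_eq`), which is the one driving the learning rate, so
the sum is self-bounding and at most `2 b_0 log K √T`. Stability: the second-order term has mean at
most `M` times the mean of `η_t`, because `tr(P_t Σ(q_t) P_t Σ(π_t)) = tr(P_t Σ(q_t)) ≤ M`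
(`integral_secondMoment_le`).

The choice `γ_t = η_t/λ` gives `φᵀ P_t φ ≤ b_t`, so the estimated losses have size at most `b_t`, as
the exponential-weights step requires. The estimator is unbiased, so the estimated linear regret has
the right mean. Since `H ≤ log K`, also `b_t ≥ b_0 √(t+1)` and `∑ η_t ≤ 2√T / b_0`. Altogether the
regret is at most `3 b_0 log K √T + 6 M √T / b_0`, and `b_0² log K = M log T` finishes the proof. -/

noncomputable section

namespace LinBandit

/-! ### Quadratic forms of positive definite matrices and their inverses. -/

section LinearAlgebra

open Matrix

variable {n : Type*} [Fintype n]

lemma dotProduct_mulVec_swap {M : Matrix n n ℝ} (hM : M.IsHermitian) (x y : n → ℝ) :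
    x ⬝ᵥ M *ᵥ y = y ⬝ᵥ M *ᵥ x := by
  rw [dotProduct_mulVec, dotProduct_comm, ← mulVec_transpose]
  congr 2

/-- Cauchy–Schwarz for the bilinear form of a positive semidefinite matrix. -/
lemma dotProduct_mulVec_sq_le {M : Matrix n n ℝ} (hM : M.PosSemidef) (x y : n → ℝ) :
    (x ⬝ᵥ M *ᵥ y) ^ 2 ≤ (x ⬝ᵥ M *ᵥ x) * (y ⬝ᵥ M *ᵥ y) := by
  have h : ∀ t : ℝ, 0 ≤ (x ⬝ᵥ M *ᵥ x) * (t * t) + (2 * (x ⬝ᵥ M *ᵥ y)) * t + y ⬝ᵥ M *ᵥ y := by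
    intro t
    have h1 := hM.dotProduct_mulVec_nonneg (t • x + y)
    simp only [star_trivial, mulVec_add, mulVec_smul, dotProduct_add, add_dotProduct,
      smul_dotProduct, dotProduct_smul, smul_eq_mul] at h1
    rw [dotProduct_mulVec_swap hM.isHermitian y x] at h1
    linarith
  have h2 := discrim_le_zero h
  rw [discrim] at h2
  nlinarith

variable [DecidableEq n]

/-- Cauchy–Schwarz for `B`, applied to `w` and `B⁻¹ z`. -/
lemma dotProduct_sq_le {B : Matrix n n ℝ} (hB : B.PosDef) (w z : n → ℝ) :
    (w ⬝ᵥ z) ^ 2 ≤ (w ⬝ᵥ B *ᵥ w) * (z ⬝ᵥ B⁻¹ *ᵥ z) := by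
  have hu : IsUnit B.det := (Matrix.isUnit_iff_isUnit_det B).1 hB.isUnit
  have h := dotProduct_mulVec_sq_le hB.posSemidef w (B⁻¹ *ᵥ z)
  rw [mulVec_mulVec, mul_nonsing_inv _ hu, one_mulVec] at h
  rwa [dotProduct_comm (B⁻¹ *ᵥ z) z] at h

/-- Adding a positive semidefinite matrix to `g • B` decreases the inverse. -/
lemma dotProduct_inv_mulVec_le {A B : Matrix n n ℝ} (hA : A.PosSemidef) (hB : B.PosDef)
    {g : ℝ} (hg : 0 < g) (z : n → ℝ) :
    z ⬝ᵥ (A + g • B)⁻¹ *ᵥ z ≤ g⁻¹ * (z ⬝ᵥ B⁻¹ *ᵥ z) := by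
  have hS : (A + g • B).PosDef := Matrix.PosDef.posSemidef_add hA (hB.smul hg)
  have hu : IsUnit (A + g • B).det := (Matrix.isUnit_iff_isUnit_det _).1 hS.isUnit
  set y := (A + g • B)⁻¹ *ᵥ z with hy
  have hz : z = A *ᵥ y + g • (B *ᵥ y) := by
    rw [← smul_mulVec, ← add_mulVec, hy, mulVec_mulVec, mul_nonsing_inv _ hu, one_mulVec]
  -- Pair `z = (A + g B) y` with `y` and drop `yᵀ A y ≥ 0`.
  have h1 : g * (y ⬝ᵥ B *ᵥ y) ≤ z ⬝ᵥ y := by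
    have := hA.dotProduct_mulVec_nonneg y
    rw [star_trivial] at this
    rw [dotProduct_comm z y]
    conv_rhs => rw [hz]
    rw [dotProduct_add, dotProduct_smul, smul_eq_mul]
    linarith
  have h2 := dotProduct_sq_le hB y z
  rw [dotProduct_comm y z] at h2
  have h3 := hB.inv.posSemidef.dotProduct_mulVec_nonneg z
  have h4 := hB.posSemidef.dotProduct_mulVec_nonneg y
  rw [star_trivial] at h3 h4
  -- Combining `h1` and `h2` leaves a common factor `zᵀ y`, which can be cancelled unless it
  -- vanishes.
  rcases (mul_nonneg hg.le h4).trans h1 |>.eq_or_lt with h0 | h0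
  · rw [← h0]; positivity
  · rw [inv_mul_eq_div, le_div_iff₀ hg]
    have h5 : (z ⬝ᵥ y) * ((z ⬝ᵥ y) * g) ≤ (z ⬝ᵥ y) * (z ⬝ᵥ B⁻¹ *ᵥ z) := by nlinarith
    exact le_of_mul_le_mul_left h5 h0

end LinearAlgebra

/-! ### Gibbs distributions and the entropic FTRL bound. -/

section Gibbs

variable {K : ℕ}

/-- The partition function of the Gibbs distribution. -/
def partition (L : Fin K → ℝ) (b : ℝ) : ℝ := ∑ a, Real.exp (-L a / b)

/-- The Gibbs distribution for the energy `L` at temperature `b`. -/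
def gibbs (L : Fin K → ℝ) (b : ℝ) (a : Fin K) : ℝ := Real.exp (-L a / b) / partition L b

/-- The minimal value of `p ↦ ⟨L, p⟩ + b ψ(p)` over the simplex. -/
def freeEnergy (L : Fin K → ℝ) (b : ℝ) : ℝ := -b * Real.log (partition L b)

lemma regularizer_eq (p : Fin K → ℝ) : regularizer p = ∑ a, p a * Real.log (p a) := by
  simp [regularizer, Real.log_inv]

lemma entropy_eq_neg_regularizer (p : Fin K → ℝ) : entropy p = -regularizer p := by
  simp [regularizer, entropy]

lemma partition_pos (hK : 0 < K) (L : Fin K → ℝ) (b : ℝ) : 0 < partition L b :=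
  Finset.sum_pos (fun _ _ => Real.exp_pos _) ⟨⟨0, hK⟩, Finset.mem_univ _⟩

lemma gibbs_pos (hK : 0 < K) (L : Fin K → ℝ) (b : ℝ) (a : Fin K) : 0 < gibbs L b a :=
  div_pos (Real.exp_pos _) (partition_pos hK L b)

lemma sum_gibbs (hK : 0 < K) (L : Fin K → ℝ) (b : ℝ) : ∑ a, gibbs L b a = 1 := by
  simp only [gibbs, ← Finset.sum_div]
  exact div_self (partition_pos hK L b).ne'

lemma gibbs_mem_stdSimplex (hK : 0 < K) (L : Fin K → ℝ) (b : ℝ) :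
    gibbs L b ∈ stdSimplex ℝ (Fin K) :=
  ⟨fun a => (gibbs_pos hK L b a).le, sum_gibbs hK L b⟩

/-- The Gibbs variational identity. -/
lemma linear_add_regularizer_eq (hK : 0 < K) {b : ℝ} (hb : 0 < b) (L : Fin K → ℝ)
    {p : Fin K → ℝ} (hp : p ∈ stdSimplex ℝ (Fin K)) :
    ∑ a, L a * p a + b * regularizer p = freeEnergy L b +
      b * ∑ a, gibbs L b a * InformationTheory.klFun (p a / gibbs L b a) := by
  -- `klFun u = u log u + 1 - u`; the correction `gibbs - p` sums to zero since both are probability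
  -- vectors.
  have h : ∀ a, gibbs L b a * InformationTheory.klFun (p a / gibbs L b a) =
      p a * Real.log (p a) + p a * (L a / b) + p a * Real.log (partition L b) +
        gibbs L b a - p a := by
    intro a
    have hg := gibbs_pos hK L b a
    have hlog : Real.log (gibbs L b a) = -L a / b - Real.log (partition L b) := by
      rw [gibbs, Real.log_div (Real.exp_pos _).ne' (partition_pos hK L b).ne', Real.log_exp]
    rw [InformationTheory.klFun]
    rcases (hp.1 a).eq_or_lt with h0 | h0
    · simp [← h0]
    · rw [Real.log_div h0.ne' hg.ne', hlog]
      field_simp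
      ring
  simp_rw [h]
  simp only [Finset.sum_add_distrib, Finset.sum_sub_distrib, sum_gibbs hK, ← Finset.sum_mul, hp.2]
  rw [← regularizer_eq, freeEnergy]
  have : b * ∑ a, p a * (L a / b) = ∑ a, L a * p a := by
    rw [Finset.mul_sum]
    refine Finset.sum_congr rfl fun a _ => ?_
    field_simp
  linear_combination -this

lemma freeEnergy_le (hK : 0 < K) {b : ℝ} (hb : 0 < b) (L : Fin K → ℝ)
    {p : Fin K → ℝ} (hp : p ∈ stdSimplex ℝ (Fin K)) :
    freeEnergy L b ≤ ∑ a, L a * p a + b * regularizer p := by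
  rw [linear_add_regularizer_eq hK hb L hp]
  have : 0 ≤ ∑ a, gibbs L b a * InformationTheory.klFun (p a / gibbs L b a) :=
    Finset.sum_nonneg fun a _ => mul_nonneg (gibbs_pos hK L b a).le
      (InformationTheory.klFun_nonneg (div_nonneg (hp.1 a) (gibbs_pos hK L b a).le))
  nlinarith

lemma linear_add_regularizer_gibbs (hK : 0 < K) {b : ℝ} (hb : 0 < b) (L : Fin K → ℝ) :
    ∑ a, L a * gibbs L b a + b * regularizer (gibbs L b) = freeEnergy L b := by
  rw [linear_add_regularizer_eq hK hb L (gibbs_mem_stdSimplex hK L b)]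
  simp [div_self (gibbs_pos hK L b _).ne', InformationTheory.klFun_one]

/-- The Gibbs distribution is the only minimizer of the regularized linear functional. -/
lemma eq_gibbs_of_isMinOn (hK : 0 < K) {b : ℝ} (hb : 0 < b) (L : Fin K → ℝ)
    {p : Fin K → ℝ} (hp : p ∈ stdSimplex ℝ (Fin K))
    (hmin : ∑ a, L a * p a + b * regularizer p ≤
      ∑ a, L a * gibbs L b a + b * regularizer (gibbs L b)) : p = gibbs L b := by
  rw [linear_add_regularizer_gibbs hK hb, linear_add_regularizer_eq hK hb L hp] at hmin
  have hnn : ∀ a ∈ Finset.univ,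
      0 ≤ gibbs L b a * InformationTheory.klFun (p a / gibbs L b a) := fun a _ =>
    mul_nonneg (gibbs_pos hK L b a).le
      (InformationTheory.klFun_nonneg (div_nonneg (hp.1 a) (gibbs_pos hK L b a).le))
  have h0 : ∑ a, gibbs L b a * InformationTheory.klFun (p a / gibbs L b a) = 0 :=
    le_antisymm (by nlinarith) (Finset.sum_nonneg hnn)
  rw [Finset.sum_eq_zero_iff_of_nonneg hnn] at h0
  funext a
  have hg := gibbs_pos hK L b a
  have h1 := (mul_eq_zero.1 (h0 a (Finset.mem_univ a))).resolve_left hg.ne'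
  rw [InformationTheory.klFun_eq_zero_iff (div_nonneg (hp.1 a) hg.le)] at h1
  rwa [div_eq_one_iff_eq hg.ne'] at h1

lemma gibbs_const (b : ℝ) (a : Fin K) :
    gibbs (fun _ : Fin K => (0 : ℝ)) b a = 1 / K := by
  simp [gibbs, partition]

lemma entropy_nonneg {p : Fin K → ℝ} (hp : p ∈ stdSimplex ℝ (Fin K)) : 0 ≤ entropy p := by
  refine Finset.sum_nonneg fun a _ => mul_nonneg (hp.1 a) ?_
  have h1 : p a ≤ 1 := hp.2 ▸ Finset.single_le_sum (fun i _ => hp.1 i) (Finset.mem_univ a)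
  rw [one_div, Real.log_inv]
  have := Real.log_nonpos (hp.1 a) h1
  linarith

lemma entropy_le_log (hK : 0 < K) {p : Fin K → ℝ} (hp : p ∈ stdSimplex ℝ (Fin K)) :
    entropy p ≤ Real.log K := by
  have h := freeEnergy_le hK one_pos (fun _ : Fin K => (0 : ℝ)) hp
  simp [freeEnergy, partition] at h
  rw [entropy_eq_neg_regularizer]
  linarith

/-- One step of exponential weights at a fixed temperature. -/
lemma sum_gibbs_mul_le (hK : 0 < K) {b : ℝ} (hb : 0 < b) (L l : Fin K → ℝ)
    (hl : ∀ a, |l a| ≤ b) :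
    ∑ a, gibbs L b a * l a ≤ freeEnergy (fun a => L a + l a) b - freeEnergy L b +
      1 / b * ∑ a, gibbs L b a * l a ^ 2 := by
  have hZ := partition_pos hK L b
  have hZ' := partition_pos hK (fun a => L a + l a) b
  have h1 : partition (fun a => L a + l a) b / partition L b ≤
      1 - (1 / b * ∑ a, gibbs L b a * l a - (1 / b) * ((1 / b) * ∑ a, gibbs L b a * l a ^ 2)) := by
    have h2 : partition (fun a => L a + l a) b / partition L b =
        ∑ a, gibbs L b a * Real.exp (-l a / b) := by
      rw [partition, Finset.sum_div]
      refine Finset.sum_congr rfl fun a _ => ?_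
      rw [gibbs, div_mul_eq_mul_div, ← Real.exp_add]
      congr 2
      ring
    have h8 : 1 - (1 / b * ∑ a, gibbs L b a * l a -
        (1 / b) * ((1 / b) * ∑ a, gibbs L b a * l a ^ 2)) =
        ∑ a, gibbs L b a * (1 - l a / b + (l a / b) ^ 2) := by
      simp only [mul_add, mul_sub, Finset.sum_add_distrib, Finset.sum_sub_distrib, mul_one,
        sum_gibbs hK, Finset.mul_sum]
      rw [sub_sub_eq_add_sub, add_sub_right_comm]
      congr 1
      · congr 1
        exact Finset.sum_congr rfl fun a _ => by ring
      · exact Finset.sum_congr rfl fun a _ => by ring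
    rw [h2, h8]
    refine Finset.sum_le_sum fun a _ => ?_
    have hx : |-l a / b| ≤ 1 := by
      rw [abs_div, abs_neg, abs_of_pos hb]
      exact (div_le_one hb).2 (hl a)
    have h3 := (abs_le.1 (Real.abs_exp_sub_one_sub_id_le hx)).2
    -- The only use of `|l a| ≤ b`: the bound `exp (-u) ≤ 1 - u + u²` for `|u| ≤ 1`.
    have h4 : Real.exp (-l a / b) ≤ 1 - l a / b + (l a / b) ^ 2 := by
      have e1 : (-l a / b) = -(l a / b) := by ring
      rw [e1] at h3 ⊢
      nlinarith
    exact mul_le_mul_of_nonneg_left h4 (gibbs_pos hK L b a).le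
  have h5 := Real.log_le_sub_one_of_pos (div_pos hZ' hZ)
  rw [Real.log_div hZ'.ne' hZ.ne'] at h5
  have h6 := mul_le_mul_of_nonneg_left (h5.trans (sub_le_sub_right h1 1)) hb.le
  have h7 : b * (1 - (1 / b * ∑ a, gibbs L b a * l a -
      (1 / b) * ((1 / b) * ∑ a, gibbs L b a * l a ^ 2)) - 1) =
      -(∑ a, gibbs L b a * l a) + 1 / b * ∑ a, gibbs L b a * l a ^ 2 := by
    field_simp
    ring
  rw [h7] at h6
  simp only [freeEnergy]
  linarith

/-- Changing the temperature costs at most the entropy of the new iterate. -/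
lemma freeEnergy_le_add_entropy (hK : 0 < K) {b b' : ℝ} (hb : 0 < b) (hb' : 0 < b')
    (L : Fin K → ℝ) :
    freeEnergy L b ≤ freeEnergy L b' + (b' - b) * entropy (gibbs L b') := by
  have h := freeEnergy_le hK hb L (gibbs_mem_stdSimplex hK L b')
  rw [← linear_add_regularizer_gibbs hK hb' L, entropy_eq_neg_regularizer]
  linarith

/-- The point mass at `j` is a competitor of zero entropy. -/
lemma freeEnergy_le_apply (hK : 0 < K) {b : ℝ} (hb : 0 < b) (L : Fin K → ℝ) (j : Fin K) :
    freeEnergy L b ≤ L j := by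
  have h := freeEnergy_le hK hb L (ite_eq_mem_stdSimplex ℝ j)
  rw [regularizer_eq] at h
  simpa using h

/-- The regret bound of follow-the-regularized-leader with the entropy regularizer. -/
lemma ftrl_regret_le (hK : 0 < K) (b : ℕ → ℝ) (hb : ∀ t, 0 < b t) (l : ℕ → Fin K → ℝ) (n : ℕ)
    (hl : ∀ t < n + 1, ∀ a, |l t a| ≤ b t) (q : ℕ → Fin K → ℝ)
    (hq : ∀ t < n + 1, q t = gibbs (fun a => ∑ s ∈ Finset.range t, l s a) (b t)) (j : Fin K) :
    ∑ t ∈ Finset.range (n + 1), (∑ a, q t a * l t a - l t j) ≤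
      b 0 * Real.log K + ∑ t ∈ Finset.range n, (b (t + 1) - b t) * entropy (q (t + 1)) +
        ∑ t ∈ Finset.range (n + 1), 1 / b t * ∑ a, q t a * l t a ^ 2 := by
  have hstep : ∀ t < n + 1, ∑ a, q t a * l t a ≤
      freeEnergy (fun a => ∑ s ∈ Finset.range (t + 1), l s a) (b t) -
        freeEnergy (fun a => ∑ s ∈ Finset.range t, l s a) (b t) +
        1 / b t * ∑ a, q t a * l t a ^ 2 := by
    intro t ht
    rw [hq t ht]
    simp_rw [Finset.sum_range_succ]
    exact sum_gibbs_mul_le hK (hb t) _ _ (hl t ht)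
  have hmain : ∀ m ≤ n, ∑ t ∈ Finset.range m, ∑ a, q t a * l t a ≤
      b 0 * Real.log K + ∑ t ∈ Finset.range m, (b (t + 1) - b t) * entropy (q (t + 1)) +
        ∑ t ∈ Finset.range m, 1 / b t * ∑ a, q t a * l t a ^ 2 +
        freeEnergy (fun a => ∑ s ∈ Finset.range m, l s a) (b m) := by
    intro m
    induction m with
    | zero => intro _; simp [freeEnergy, partition]
    | succ m ih =>
      intro hm
      have h1 := ih (by omega)
      have h2 := hstep m (by omega)
      have h3 := freeEnergy_le_add_entropy hK (hb m) (hb (m + 1))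
        (fun a => ∑ s ∈ Finset.range (m + 1), l s a)
      rw [← hq (m + 1) (by omega)] at h3
      rw [Finset.sum_range_succ, Finset.sum_range_succ (fun t => (b (t + 1) - b t) * _),
        Finset.sum_range_succ (fun t => 1 / b t * _)]
      linarith
  have h1 := hmain n le_rfl
  have h2 := hstep n (by omega)
  have h3 := freeEnergy_le_apply hK (hb n) (fun a => ∑ s ∈ Finset.range (n + 1), l s a) j
  rw [Finset.sum_sub_distrib, Finset.sum_range_succ (fun t => ∑ a, q t a * l t a),
    Finset.sum_range_succ (fun t => 1 / b t * _)]
  linarith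

end Gibbs

/-! ### Sums of square-root type. -/

section LearningRate

lemma sum_inv_sqrt_le (n : ℕ) :
    ∑ t ∈ Finset.range n, 1 / √((t : ℝ) + 1) ≤ 2 * √(n : ℝ) := by
  induction n with
  | zero => simp
  | succ n ih =>
    rw [Finset.sum_range_succ]
    have hu : 0 < √((n : ℝ) + 1) := Real.sqrt_pos.2 (by positivity)
    have hv : 0 ≤ √(n : ℝ) := Real.sqrt_nonneg _
    have hu2 : √((n : ℝ) + 1) ^ 2 = n + 1 := Real.sq_sqrt (by positivity)
    have hv2 : √(n : ℝ) ^ 2 = n := Real.sq_sqrt (by positivity)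
    -- With `u² - v² = 1` and `v ≤ u`, one has `2 (u - v) = 2 / (u + v) ≥ 1 / u`.
    have h : 1 / √((n : ℝ) + 1) ≤ 2 * √((n : ℝ) + 1) - 2 * √(n : ℝ) := by
      rw [div_le_iff₀ hu]
      nlinarith [sq_nonneg (√((n : ℝ) + 1) - √(n : ℝ))]
    push_cast
    linarith

variable {a : ℕ → ℝ}

/-- The denominator lags one index behind the numerator, but `a (t + 1) ≤ 1` makes `1 + S_t ≥
S_{t+1}` for the partial sums `S`. Each term is therefore at most twice the increment of `√S`. -/
lemma sum_div_sqrt_le (n : ℕ) (h0 : ∀ t < n + 1, 0 ≤ a t) (h1 : ∀ t < n + 1, a t ≤ 1) :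
    ∑ t ∈ Finset.range n, a (t + 1) / √(1 + ∑ s ∈ Finset.range (t + 1), a s) ≤
      2 * √((n : ℝ) + 1) := by
  have hS : ∀ m ≤ n + 1, 0 ≤ ∑ s ∈ Finset.range m, a s := fun m hm =>
    Finset.sum_nonneg fun s hs => h0 s ((Finset.mem_range.1 hs).trans_le hm)
  have key : ∀ m ≤ n, ∑ t ∈ Finset.range m, a (t + 1) / √(1 + ∑ s ∈ Finset.range (t + 1), a s) ≤
      2 * √(∑ s ∈ Finset.range (m + 1), a s) := by
    intro m
    induction m with
    | zero => intro _; simp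
    | succ m ih =>
      intro hm
      have ih := ih (by omega)
      rw [Finset.sum_range_succ, Finset.sum_range_succ _ (m + 1)]
      set S := ∑ s ∈ Finset.range (m + 1), a s with hSd
      have hS0 : 0 ≤ S := hS _ (by omega)
      have ha0 := h0 (m + 1) (by omega)
      have ha1 := h1 (m + 1) (by omega)
      have hw : 0 < √(1 + S) := Real.sqrt_pos.2 (by positivity)
      have hv : 0 ≤ √S := Real.sqrt_nonneg _
      have hv2 : √S ^ 2 = S := Real.sq_sqrt hS0
      have hu2 : √(S + a (m + 1)) ^ 2 = S + a (m + 1) := Real.sq_sqrt (by positivity)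
      have huv : √S ≤ √(S + a (m + 1)) := Real.sqrt_le_sqrt (by linarith)
      have huw : √(S + a (m + 1)) ≤ √(1 + S) := Real.sqrt_le_sqrt (by linarith)
      have h : a (m + 1) / √(1 + S) ≤ 2 * √(S + a (m + 1)) - 2 * √S := by
        rw [div_le_iff₀ hw]
        nlinarith
      linarith
  refine (key n le_rfl).trans ?_
  gcongr
  calc ∑ s ∈ Finset.range (n + 1), a s ≤ ∑ s ∈ Finset.range (n + 1), 1 :=
        Finset.sum_le_sum fun s hs => h1 s (Finset.mem_range.1 hs)
    _ = (n : ℝ) + 1 := by simp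

end LearningRate

/-! ### Bounded functions, the source of all integrability. -/

section Bounded

/-- A real function with bounded absolute value. -/
def IsBdd {α : Type*} (f : α → ℝ) : Prop := ∃ C, ∀ x, |f x| ≤ C

namespace IsBdd

variable {α β : Type*} {f g : α → ℝ}

lemma const (c : ℝ) : IsBdd fun _ : α => c := ⟨|c|, fun _ => le_rfl⟩

lemma add (hf : IsBdd f) (hg : IsBdd g) : IsBdd fun x => f x + g x := by
  obtain ⟨C, hC⟩ := hf
  obtain ⟨D, hD⟩ := hg
  exact ⟨C + D, fun x => (abs_add_le _ _).trans (add_le_add (hC x) (hD x))⟩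

lemma neg (hf : IsBdd f) : IsBdd fun x => -f x := by
  simpa only [IsBdd, abs_neg] using hf

lemma sub (hf : IsBdd f) (hg : IsBdd g) : IsBdd fun x => f x - g x := by
  simpa only [sub_eq_add_neg] using hf.add hg.neg

lemma mul (hf : IsBdd f) (hg : IsBdd g) : IsBdd fun x => f x * g x := by
  obtain ⟨C, hC⟩ := hf
  obtain ⟨D, hD⟩ := hg
  exact ⟨C * D, fun x => (abs_mul _ _).trans_le
    (mul_le_mul (hC x) (hD x) (abs_nonneg _) ((abs_nonneg _).trans (hC x)))⟩

lemma sum {ι : Type*} {s : Finset ι} {f : ι → α → ℝ} (hf : ∀ i ∈ s, IsBdd (f i)) :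
    IsBdd fun x => ∑ i ∈ s, f i x := by
  classical
  induction s using Finset.induction_on with
  | empty => simpa using const 0
  | insert i s hi ih =>
    simp only [Finset.sum_insert hi]
    exact (hf i (Finset.mem_insert_self i s)).add
      (ih fun j hj => hf j (Finset.mem_insert_of_mem hj))

lemma comp (hf : IsBdd f) (h : β → α) : IsBdd fun x => f (h x) := by
  obtain ⟨C, hC⟩ := hf
  exact ⟨C, fun x => hC _⟩

lemma of_mem_Icc {a b : ℝ} (h : ∀ x, f x ∈ Set.Icc a b) : IsBdd f :=
  ⟨max |a| |b|, fun x => abs_le_max_abs_abs (h x).1 (h x).2⟩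

lemma of_sq_le {C : ℝ} (h : ∀ x, f x ^ 2 ≤ C) : IsBdd f :=
  ⟨√C, fun x => Real.abs_le_sqrt (h x)⟩

lemma integrable [MeasurableSpace α] {μ : Measure α} [IsFiniteMeasure μ] (hf : IsBdd f)
    (hm : Measurable f) : Integrable f μ := by
  obtain ⟨C, hC⟩ := hf
  exact Integrable.of_bound hm.aestronglyMeasurable C (Filter.Eventually.of_forall hC)

lemma integral [MeasurableSpace β] {G : Measure β} [IsProbabilityMeasure G] {f : α → β → ℝ}
    (hf : IsBdd fun p : α × β => f p.1 p.2) : IsBdd fun x => ∫ y, f x y ∂G := by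
  obtain ⟨C, hC⟩ := hf
  refine ⟨C, fun x => ?_⟩
  have h := norm_integral_le_of_norm_le_const (μ := G) (f := f x) (C := C)
    (Filter.Eventually.of_forall fun y => hC (x, y))
  simpa using h

end IsBdd

lemma isBdd_of_mem_stdSimplex {K : ℕ} {α : Type*} {p : α → Fin K → ℝ}
    (hp : ∀ x, p x ∈ stdSimplex ℝ (Fin K)) (a : Fin K) :
    IsBdd fun x => p x a :=
  IsBdd.of_mem_Icc (a := 0) (b := 1) fun x => ⟨(hp x).1 a,
    (hp x).2 ▸ Finset.single_le_sum (fun i _ => (hp x).1 i) (Finset.mem_univ a)⟩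

end Bounded

/-! ### Feature covariances and the trace bound for mixtures. -/

section Covariance

open Matrix

variable {K d : ℕ} {𝒳 : Type*} [MeasurableSpace 𝒳] {G : Measure 𝒳}
  {φ : Fin K → 𝒳 → Fin d → ℝ} {p q : 𝒳 → Fin K → ℝ}

variable {Z : Set (Fin d → ℝ)} {lam : ℝ} {e : 𝒳 → Fin K → ℝ}

/-- `Z` is not assumed bounded. Cauchy–Schwarz against a basis vector converts the bound on the form
of `Σ(e)⁻¹` into a bound on each coordinate. -/
lemma IsExplorationPolicy.isBdd_feature (he : IsExplorationPolicy G φ Z lam e)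
    (hZ : ∀ a x, φ a x ∈ Z) (a : Fin K) (i : Fin d) : IsBdd fun x => φ a x i := by
  refine IsBdd.of_sq_le
    (C := (Pi.single i 1 ⬝ᵥ covMatrix G φ e *ᵥ Pi.single i 1) * (1 / lam)) fun x => ?_
  have h := dotProduct_sq_le he.posDef (Pi.single i 1) (φ a x)
  rw [single_one_dotProduct] at h
  refine h.trans (mul_le_mul_of_nonneg_left (he.quadForm_le _ (hZ a x)) ?_)
  have := he.posDef.posSemidef.dotProduct_mulVec_nonneg (Pi.single i 1)
  rwa [star_trivial] at this

variable [IsProbabilityMeasure G]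

lemma integrable_covMatrix (hφ : ∀ a, Measurable (φ a)) (hB : ∀ a i, IsBdd fun x => φ a x i)
    (hpm : ∀ a, Measurable fun x => p x a) (hpb : ∀ a, IsBdd fun x => p x a) (i j : Fin d) :
    Integrable (fun x => ∑ a, p x a * (φ a x i * φ a x j)) G := by
  refine IsBdd.integrable (IsBdd.sum fun a _ => (hpb a).mul ((hB a i).mul (hB a j))) ?_
  have := fun a => measurable_pi_iff.1 (hφ a)
  fun_prop

/-- The left side is `tr(N Σ(p))` because `Σ(p)` is symmetric. The identity passes between traces
and averaged quadratic forms, and is used in both directions. -/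
lemma sum_mul_covMatrix (hφ : ∀ a, Measurable (φ a)) (hB : ∀ a i, IsBdd fun x => φ a x i)
    (hpm : ∀ a, Measurable fun x => p x a) (hpb : ∀ a, IsBdd fun x => p x a)
    (N : Matrix (Fin d) (Fin d) ℝ) :
    ∑ i, ∑ j, N i j * covMatrix G φ p i j =
      ∫ x, ∑ a, p x a * (φ a x ⬝ᵥ N *ᵥ φ a x) ∂G := by
  have hi := integrable_covMatrix (G := G) hφ hB hpm hpb
  have h : ∀ x, ∑ a, p x a * (φ a x ⬝ᵥ N *ᵥ φ a x) =
      ∑ i, ∑ j, N i j * ∑ a, p x a * (φ a x i * φ a x j) := by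
    intro x
    simp only [dotProduct, mulVec, Finset.mul_sum]
    rw [Finset.sum_comm]
    refine Finset.sum_congr rfl fun i _ => ?_
    rw [Finset.sum_comm]
    exact Finset.sum_congr rfl fun j _ => Finset.sum_congr rfl fun a _ => by ring
  refine ((integral_congr_ae (Filter.Eventually.of_forall h)).trans ?_).symm
  refine (integral_finsetSum _ fun i _ =>
    integrable_finsetSum _ fun j _ => (hi i j).const_mul (N i j)).trans ?_
  refine Finset.sum_congr rfl fun i _ => ?_
  refine (integral_finsetSum _ fun j _ => (hi i j).const_mul (N i j)).trans ?_
  exact Finset.sum_congr rfl fun j _ => integral_const_mul (N i j) _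

/-- The rank-one case `N = w zᵀ` of `sum_mul_covMatrix`. -/
lemma dotProduct_covMatrix_mulVec (hφ : ∀ a, Measurable (φ a))
    (hB : ∀ a i, IsBdd fun x => φ a x i)
    (hpm : ∀ a, Measurable fun x => p x a) (hpb : ∀ a, IsBdd fun x => p x a) (w z : Fin d → ℝ) :
    w ⬝ᵥ covMatrix G φ p *ᵥ z = ∫ x, ∑ a, p x a * ((w ⬝ᵥ φ a x) * (φ a x ⬝ᵥ z)) ∂G := by
  have h := sum_mul_covMatrix (G := G) hφ hB hpm hpb (vecMulVec w z)
  simp only [vecMulVec_mulVec, dotProduct_smul, vecMulVec_apply, MulOpposite.smul_eq_mul_unop,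
    MulOpposite.unop_op] at h
  simp_rw [dotProduct_comm w]
  simp_rw [dotProduct_comm z] at h
  rw [← h]
  simp only [dotProduct, mulVec, Finset.sum_mul]
  exact Finset.sum_congr rfl fun i _ => Finset.sum_congr rfl fun j _ => by ring

lemma covMatrix_posSemidef (hφ : ∀ a, Measurable (φ a)) (hB : ∀ a i, IsBdd fun x => φ a x i)
    (hpm : ∀ a, Measurable fun x => p x a) (hp : ∀ x, p x ∈ stdSimplex ℝ (Fin K)) :
    (covMatrix G φ p).PosSemidef := by
  refine PosSemidef.of_dotProduct_mulVec_nonneg ?_ fun w => ?_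
  · ext i j
    simp [covMatrix, mul_comm (φ _ _ i)]
  · rw [star_trivial, dotProduct_covMatrix_mulVec hφ hB hpm (isBdd_of_mem_stdSimplex hp)]
    refine integral_nonneg fun x => Finset.sum_nonneg fun a _ => mul_nonneg ((hp x).1 a) ?_
    rw [dotProduct_comm w]
    exact mul_self_nonneg _

lemma covMatrix_mix (hφ : ∀ a, Measurable (φ a)) (hB : ∀ a i, IsBdd fun x => φ a x i)
    (hpm : ∀ a, Measurable fun x => p x a) (hpb : ∀ a, IsBdd fun x => p x a)
    (hqm : ∀ a, Measurable fun x => q x a) (hqb : ∀ a, IsBdd fun x => q x a) (g h : ℝ) :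
    covMatrix G φ (fun x a => g * p x a + h * q x a) =
      g • covMatrix G φ p + h • covMatrix G φ q := by
  ext i j
  simp only [covMatrix, Matrix.of_apply, Matrix.add_apply, Matrix.smul_apply, smul_eq_mul]
  rw [← integral_const_mul, ← integral_const_mul, ← integral_add
    ((integrable_covMatrix hφ hB hpm hpb i j).const_mul g)
    ((integrable_covMatrix hφ hB hqm hqb i j).const_mul h)]
  congr 1
  ext x
  rw [Finset.mul_sum, Finset.mul_sum, ← Finset.sum_add_distrib]
  exact Finset.sum_congr rfl fun a _ => by ring

section Mixture

variable {g : ℝ}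

lemma covMatrix_mix_posDef (he : IsExplorationPolicy G φ Z lam e) (hφ : ∀ a, Measurable (φ a))
    (hZ : ∀ a x, φ a x ∈ Z) (hqm : ∀ a, Measurable fun x => q x a)
    (hq : ∀ x, q x ∈ stdSimplex ℝ (Fin K)) (hg : 0 < g) (hg1 : g ≤ 1) :
    (covMatrix G φ fun x a => (1 - g) * q x a + g * e x a).PosDef := by
  rw [covMatrix_mix hφ (he.isBdd_feature hZ) hqm (isBdd_of_mem_stdSimplex hq)
    he.measurable_policy (isBdd_of_mem_stdSimplex he.mem_simplex)]
  exact Matrix.PosDef.posSemidef_add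
    ((covMatrix_posSemidef hφ (he.isBdd_feature hZ) hqm hq).smul (by linarith : 0 ≤ 1 - g))
    (he.posDef.smul hg)

lemma covMatrix_mix_inv_le (he : IsExplorationPolicy G φ Z lam e) (hφ : ∀ a, Measurable (φ a))
    (hZ : ∀ a x, φ a x ∈ Z) (hqm : ∀ a, Measurable fun x => q x a)
    (hq : ∀ x, q x ∈ stdSimplex ℝ (Fin K)) (hg : 0 < g) (hg1 : g ≤ 1) (w : Fin d → ℝ) :
    w ⬝ᵥ (covMatrix G φ fun x a => (1 - g) * q x a + g * e x a)⁻¹ *ᵥ w ≤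
      g⁻¹ * (w ⬝ᵥ (covMatrix G φ e)⁻¹ *ᵥ w) := by
  rw [covMatrix_mix hφ (he.isBdd_feature hZ) hqm (isBdd_of_mem_stdSimplex hq)
    he.measurable_policy (isBdd_of_mem_stdSimplex he.mem_simplex)]
  exact dotProduct_inv_mulVec_le
    ((covMatrix_posSemidef hφ (he.isBdd_feature hZ) hqm hq).smul (by linarith : 0 ≤ 1 - g))
    he.posDef hg w

/-- The trace of `Σ(q) Σ(π)⁻¹` for the mixture `π = (1 - g) q + g e`. -/
lemma integral_quadForm_inv_le (he : IsExplorationPolicy G φ Z lam e)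
    (hφ : ∀ a, Measurable (φ a))
    (hZ : ∀ a x, φ a x ∈ Z) (hqm : ∀ a, Measurable fun x => q x a)
    (hq : ∀ x, q x ∈ stdSimplex ℝ (Fin K)) (hg : 0 < g) (hg1 : g ≤ 1) :
    ∫ x, ∑ a, q x a * (φ a x ⬝ᵥ
        (covMatrix G φ fun x a => (1 - g) * q x a + g * e x a)⁻¹ *ᵥ φ a x) ∂G ≤
      1 / lam + d := by
  have hB := he.isBdd_feature hZ
  have hqb := isBdd_of_mem_stdSimplex hq
  have heb := isBdd_of_mem_stdSimplex he.mem_simplex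
  have hS := covMatrix_mix_posDef he hφ hZ hqm hq hg hg1
  have hle := covMatrix_mix_inv_le he hφ hZ hqm hq hg hg1
  have hmix := covMatrix_mix (G := G) hφ hB hqm hqb he.measurable_policy heb (1 - g) g
  set S := covMatrix G φ fun x a => (1 - g) * q x a + g * e x a with hSdef
  have hu : IsUnit S.det := (Matrix.isUnit_iff_isUnit_det _).1 hS.isUnit
  have hpos : ∀ z, 0 ≤ z ⬝ᵥ S⁻¹ *ᵥ z := fun z => by
    simpa using hS.inv.posSemidef.dotProduct_mulVec_nonneg z
  have hq1 := sum_mul_covMatrix (G := G) hφ hB hqm hqb S⁻¹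
  have he1 := sum_mul_covMatrix (G := G) hφ hB he.measurable_policy heb S⁻¹
  set τ := ∫ x, ∑ a, q x a * (φ a x ⬝ᵥ S⁻¹ *ᵥ φ a x) ∂G
  set τe := ∫ x, ∑ a, e x a * (φ a x ⬝ᵥ S⁻¹ *ᵥ φ a x) ∂G
  have hτe : 0 ≤ τe := integral_nonneg fun x => Finset.sum_nonneg fun a _ =>
    mul_nonneg ((he.mem_simplex x).1 a) (hpos _)
  -- This is `tr(S⁻¹ S) = d`, with the second `S` expanded as a mixture.
  have htr : (1 - g) * τ + g * τe = d := by
    rw [← hq1, ← he1]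
    have h1 : ∑ i, ∑ j, S⁻¹ i j * S i j = d := by
      have h2 : (S⁻¹ * S).trace = d := by
        rw [nonsing_inv_mul _ hu, trace_one, Fintype.card_fin]
      rw [← h2, Matrix.trace]
      refine Finset.sum_congr rfl fun i _ => ?_
      rw [diag_apply, mul_apply]
      refine Finset.sum_congr rfl fun j _ => ?_
      have := hS.isHermitian.apply i j
      rw [star_trivial] at this
      rw [this]
    rw [← h1]
    simp_rw [Finset.mul_sum, ← Finset.sum_add_distrib]
    refine Finset.sum_congr rfl fun i _ => Finset.sum_congr rfl fun j _ => ?_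
    nth_rw 4 [hmix]
    simp only [Matrix.add_apply, Matrix.smul_apply, smul_eq_mul]
    ring
  -- Here the exploration part enters: the form of `S⁻¹` is at most `g⁻¹` times that of `Σ(e)⁻¹`.
  have hτ : g * τ ≤ 1 / lam := by
    have h1 : ∀ x, ∑ a, q x a * (φ a x ⬝ᵥ S⁻¹ *ᵥ φ a x) ≤ g⁻¹ * (1 / lam) := by
      intro x
      calc ∑ a, q x a * (φ a x ⬝ᵥ S⁻¹ *ᵥ φ a x) ≤ ∑ a, q x a * (g⁻¹ * (1 / lam)) :=
            Finset.sum_le_sum fun a _ => mul_le_mul_of_nonneg_left ((hle _).trans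
              (mul_le_mul_of_nonneg_left (he.quadForm_le _ (hZ a x)) (inv_nonneg.2 hg.le)))
              ((hq x).1 a)
        _ = g⁻¹ * (1 / lam) := by rw [← Finset.sum_mul, (hq x).2, one_mul]
    have h2 : τ ≤ g⁻¹ * (1 / lam) := by
      have := integral_mono_of_nonneg (μ := G)
        (Filter.Eventually.of_forall fun x => Finset.sum_nonneg fun a _ =>
          mul_nonneg ((hq x).1 a) (hpos (φ a x)))
        (integrable_const (g⁻¹ * (1 / lam))) (Filter.Eventually.of_forall h1)
      simpa using this
    calc g * τ ≤ g * (g⁻¹ * (1 / lam)) := mul_le_mul_of_nonneg_left h2 hg.le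
      _ = 1 / lam := by field_simp
  -- Adding `(1 - g) τ ≤ d` and `g τ ≤ 1 / lam` avoids a division by `1 - g`, so `g = 1` is allowed.
  nlinarith

end Mixture

end Covariance

/-! ### Fresh randomness: independence and conditional expectation. -/

section Probability

lemma measurable_comp_pair {Ω 𝒳 S β : Type*} {m : MeasurableSpace Ω} [MeasurableSpace 𝒳]
    [MeasurableSpace S] [MeasurableSpace β] {f : S × 𝒳 → β} (hf : Measurable f) {U : Ω → S}
    {X : Ω → 𝒳} (hU : Measurable[m] U) (hX : Measurable[m] X) :
    Measurable[m] fun ω => f (U ω, X ω) := hf.comp (hU.prodMk hX)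

variable {Ω 𝒳 S : Type*} {m mΩ : MeasurableSpace Ω} [MeasurableSpace 𝒳] [MeasurableSpace S]
  {μ : Measure Ω} [IsProbabilityMeasure μ]

/-- Integrating out a random variable that is independent of the past. -/
lemma integral_of_indep {G : Measure 𝒳} (hm : m ≤ mΩ) {X : Ω → 𝒳}
    (hX : Measurable X) (hG : μ.map X = G)
    (hind : Indep (MeasurableSpace.comap X inferInstance) m μ) {U : Ω → S}
    (hU : Measurable[m] U) {f : S × 𝒳 → ℝ} (hf : Measurable f)
    (hb : IsBdd fun p : Ω × 𝒳 => f (U p.1, p.2)) :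
    ∫ ω, f (U ω, X ω) ∂μ = ∫ ω, ∫ x, f (U ω, x) ∂G ∂μ := by
  have hU' : Measurable U := hU.mono hm le_rfl
  have hind' : IndepFun U X μ := by
    rw [IndepFun_iff_Indep]
    exact indep_of_indep_of_le_left hind.symm hU.comap_le
  have hmap := hind'.map_prod_eq_prod_map_map hU'.aemeasurable hX.aemeasurable
  have : IsProbabilityMeasure (μ.map X) := Measure.isProbabilityMeasure_map hX.aemeasurable
  have : IsProbabilityMeasure (μ.map U) := Measure.isProbabilityMeasure_map hU'.aemeasurable
  have hint : Integrable (fun ω => f (U ω, X ω)) μ :=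
    (hb.comp fun ω => (ω, X ω)).integrable (hf.comp (hU'.prodMk hX))
  have hint' : Integrable f ((μ.map U).prod (μ.map X)) := by
    rw [← hmap, integrable_map_measure hf.aestronglyMeasurable (hU'.prodMk hX).aemeasurable]
    exact hint
  rw [← integral_map (hU'.prodMk hX).aemeasurable (f := f) hf.aestronglyMeasurable, hmap,
    integral_prod f hint', hG, integral_map hU'.aemeasurable]
  subst hG
  exact (hf.stronglyMeasurable.integral_prod_right').aestronglyMeasurable

/-- Replacing a factor by its conditional expectation. -/
lemma integral_mul_of_condExp (hm : m ≤ mΩ) {f g h : Ω → ℝ} (hf : Measurable[m] f) {c : ℝ}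
    (hc : ∀ᵐ ω ∂μ, |f ω| ≤ c) (hg : Integrable g μ) (hh : μ[g | m] =ᵐ[μ] h) :
    ∫ ω, f ω * g ω ∂μ = ∫ ω, f ω * h ω ∂μ := by
  rw [← integral_condExp hm (f := fun ω => f ω * g ω)]
  refine integral_congr_ae ?_
  have h1 := condExp_stronglyMeasurable_mul_of_bound hm hf.stronglyMeasurable hg c hc
  filter_upwards [h1, hh] with ω h2 h3
  rw [show (fun ω => f ω * g ω) = f * g from rfl, h2, Pi.mul_apply, h3]

end Probability

/-- Cramer's rule. The formula also covers singular matrices, where both the inverse matrix and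
`det⁻¹` are zero by convention. -/
lemma measurable_matrix_inv {d : ℕ} (i j : Fin d) :
    Measurable fun M : Fin d → Fin d → ℝ => (Matrix.of M)⁻¹ i j := by
  have h : ∀ M : Fin d → Fin d → ℝ,
      (Matrix.of M)⁻¹ i j = (Matrix.of M).det⁻¹ * (Matrix.of M).adjugate i j := by
    intro M
    rw [Matrix.inv_def, Matrix.smul_apply, smul_eq_mul, Ring.inverse_eq_inv']
  simp_rw [h]
  have hc : Continuous fun M : Fin d → Fin d → ℝ => Matrix.of M := continuous_id
  exact (hc.matrix_det.measurable.inv).mul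
    ((continuous_apply j).comp ((continuous_apply i).comp hc.matrix_adjugate)).measurable

/-! ### The state of the algorithm: closed form and predictability. -/

namespace Run

open Matrix

variable {K d T : ℕ} {𝒳 Ω : Type*} [MeasurableSpace 𝒳] (R : Run K d T 𝒳 Ω)

/-- The iterate as a function of the cumulative estimate and the inverse learning rate. -/
def iterateAt (s : (Fin d → ℝ) × ℝ × (Fin d → ℝ)) (x : 𝒳) (a : Fin K) : ℝ :=
  gibbs (fun a => s.1 ⬝ᵥ R.φ a x) s.2.1 a

/-- The mixing weight as a function of the inverse learning rate. -/
def gammaAt (s : (Fin d → ℝ) × ℝ × (Fin d → ℝ)) : ℝ := 1 / s.2.1 / R.lam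

/-- The policy as a function of the cumulative estimate and the inverse learning rate. -/
def policyAt (s : (Fin d → ℝ) × ℝ × (Fin d → ℝ)) (x : 𝒳) (a : Fin K) : ℝ :=
  (1 - R.gammaAt s) * R.iterateAt s x a + R.gammaAt s * R.e x a

/-- The inverse covariance as a function of the cumulative estimate and the inverse learning
rate. -/
def precAt (s : (Fin d → ℝ) × ℝ × (Fin d → ℝ)) : Matrix (Fin d) (Fin d) ℝ :=
  (covMatrix R.G R.φ (R.policyAt s))⁻¹

/-- The cumulative parameter estimate. -/
def cumTheta (t : ℕ) (ω : Ω) : Fin d → ℝ := ∑ s ∈ Finset.range t, R.thetaHat s ω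

/-- The cumulative estimate, the inverse learning rate and the parameter of round `t`. -/
def param (t : ℕ) (ω : Ω) : (Fin d → ℝ) × ℝ × (Fin d → ℝ) :=
  (R.cumTheta t ω, R.invEta ω t, R.θ t ω)

/-- All the hypotheses of the regret bound. -/
structure IsSetting [mΩ : MeasurableSpace Ω] (μ : Measure Ω) (ℱ : Filtration ℕ mΩ)
    (Z Θ : Set (Fin d → ℝ)) : Prop where
  two_le_arms : 2 ≤ K
  two_le_rounds : 2 ≤ T
  model : IsContextModel R.G R.φ Z
  exploration : IsExplorationPolicy R.G R.φ Z R.lam R.e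
  bounded : R.IsBounded μ Z Θ
  adversarial : R.IsAdversarial μ ℱ Θ
  algorithm : R.IsBoBWRealFTRL
  gamma_zero_le : ∀ ω, R.gamma 0 ω ≤ 1

namespace IsSetting

variable {R} [mΩ : MeasurableSpace Ω] {μ : Measure Ω} {ℱ : Filtration ℕ mΩ}
  {Z Θ : Set (Fin d → ℝ)} (h : R.IsSetting μ ℱ Z Θ)

include h

lemma arms_pos : 0 < K := by have := h.two_le_arms; omega

lemma log_arms_pos : 0 < Real.log K := Real.log_pos (by exact_mod_cast h.two_le_arms)

lemma log_rounds_pos : 0 < Real.log T := Real.log_pos (by exact_mod_cast h.two_le_rounds)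

lemma lam_pos : 0 < R.lam := h.exploration.lam_pos

lemma const_pos : 0 < 1 / R.lam + (d : ℝ) := by
  have := h.lam_pos
  positivity

lemma invEtaFirst_pos : 0 < R.invEtaFirst := by
  have h1 := h.const_pos
  have h2 := h.log_arms_pos
  have h3 := h.log_rounds_pos
  exact Real.sqrt_pos.2 (by positivity)

lemma invEta_le_succ (ω : Ω) (t : ℕ) : R.invEta ω t ≤ R.invEta ω (t + 1) := by
  have := h.invEtaFirst_pos
  rw [invEta]
  have : 0 ≤ R.invEtaFirst * (1 /
      √(1 + (Real.log K)⁻¹ * ∑ s ∈ Finset.range (t + 1), entropy (R.q s ω (R.X s ω)))) := by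
    positivity
  linarith

lemma invEtaFirst_le (ω : Ω) (t : ℕ) : R.invEtaFirst ≤ R.invEta ω t := by
  induction t with
  | zero => exact le_rfl
  | succ t ih => exact ih.trans (h.invEta_le_succ ω t)

lemma invEta_pos (ω : Ω) (t : ℕ) : 0 < R.invEta ω t :=
  h.invEtaFirst_pos.trans_le (h.invEtaFirst_le ω t)

lemma gammaAt_pos (t : ℕ) (ω : Ω) : 0 < R.gammaAt (R.param t ω) :=
  div_pos (one_div_pos.2 (h.invEta_pos ω t)) h.lam_pos

/-- The inverse rates never fall below the first one, so the first mixing weight is the largest. -/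
lemma gammaAt_le_one (t : ℕ) (ω : Ω) : R.gammaAt (R.param t ω) ≤ 1 := by
  refine le_trans ?_ (h.gamma_zero_le ω)
  exact div_le_div_of_nonneg_right (one_div_le_one_div_of_le h.invEtaFirst_pos
    (h.invEtaFirst_le ω t)) h.lam_pos.le

/-- The uniform first iterate is the Gibbs distribution of zero energy; later ones are identified by
uniqueness of the minimizer. Measurability of `q` is not part of the hypotheses and comes from this
formula. -/
lemma q_eq {t : ℕ} (ht : t < T) (ω : Ω) (x : 𝒳) : R.q t ω x = R.iterateAt (R.param t ω) x := by
  rcases Nat.eq_zero_or_pos t with rfl | h0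
  · funext a
    rw [h.algorithm.first, iterateAt]
    simp only [param, cumTheta, Finset.range_zero, Finset.sum_empty, zero_dotProduct]
    rw [gibbs_const]
  · have hobj : ∀ p, R.objective t ω x p =
        ∑ a, (R.cumTheta t ω ⬝ᵥ R.φ a x) * p a + R.invEta ω t * regularizer p := by
      intro p
      rw [objective, eta, one_div_one_div]
      congr 1
      rw [Finset.sum_comm]
      refine Finset.sum_congr rfl fun a _ => ?_
      rw [cumTheta, sum_dotProduct, Finset.sum_mul]
      rfl
    have hmin := h.algorithm.isMinOn t h0 ht ω x (gibbs_mem_stdSimplex h.arms_pos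
      (fun a => R.cumTheta t ω ⬝ᵥ R.φ a x) (R.invEta ω t))
    simp only [Set.mem_ofPred_eq, hobj] at hmin
    exact eq_gibbs_of_isMinOn h.arms_pos (h.invEta_pos ω t) _
      (h.algorithm.mem_simplex t h0 ht ω x) hmin

lemma iterateAt_mem (s : (Fin d → ℝ) × ℝ × (Fin d → ℝ)) (x : 𝒳) :
    R.iterateAt s x ∈ stdSimplex ℝ (Fin K) := gibbs_mem_stdSimplex h.arms_pos _ _

lemma policy_eq {t : ℕ} (ht : t < T) (ω : Ω) : R.policy t ω = R.policyAt (R.param t ω) := by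
  funext x a
  rw [policy, h.q_eq ht]
  rfl

lemma policyAt_mem (t : ℕ) (ω : Ω) (x : 𝒳) :
    R.policyAt (R.param t ω) x ∈ stdSimplex ℝ (Fin K) := by
  have h1 := h.gammaAt_pos t ω
  have h2 := h.gammaAt_le_one t ω
  exact convex_stdSimplex ℝ (Fin K) (h.iterateAt_mem _ x) (h.exploration.mem_simplex x)
    (by linarith) h1.le (by ring)

lemma cov_inv_eq {t : ℕ} (ht : t < T) (ω : Ω) : (R.cov t ω)⁻¹ = R.precAt (R.param t ω) := by
  rw [cov, h.policy_eq ht]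
  rfl

lemma measurable_iterateAt (a : Fin K) :
    Measurable fun p : ((Fin d → ℝ) × ℝ × (Fin d → ℝ)) × 𝒳 => R.iterateAt p.1 p.2 a := by
  have := fun a => measurable_pi_iff.1 (h.model.measurable_feature a)
  unfold iterateAt gibbs partition dotProduct
  fun_prop

lemma measurable_policyAt (a : Fin K) :
    Measurable fun p : ((Fin d → ℝ) × ℝ × (Fin d → ℝ)) × 𝒳 => R.policyAt p.1 p.2 a := by
  have := h.measurable_iterateAt a
  have := h.exploration.measurable_policy a
  unfold policyAt gammaAt
  fun_prop

lemma measurable_precAt (i j : Fin d) :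
    Measurable fun s : (Fin d → ℝ) × ℝ × (Fin d → ℝ) => R.precAt s i j := by
  have := h.model.isProbabilityMeasure
  refine (measurable_matrix_inv i j).comp
    (g := fun M : Fin d → Fin d → ℝ => (Matrix.of M)⁻¹ i j)
    (f := fun (s : (Fin d → ℝ) × ℝ × (Fin d → ℝ)) (i j : Fin d) => ∫ x, ∑ a, R.policyAt s x a *
      (R.φ a x i * R.φ a x j) ∂ R.G) ?_
  refine measurable_pi_iff.2 fun i => measurable_pi_iff.2 fun j => ?_
  refine (StronglyMeasurable.integral_prod_right' (ν := R.G)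
    (f := fun p : ((Fin d → ℝ) × ℝ × (Fin d → ℝ)) × 𝒳 => ∑ a, R.policyAt p.1 p.2 a *
      (R.φ a p.2 i * R.φ a p.2 j)) (Measurable.stronglyMeasurable ?_)).measurable
  have := fun a => measurable_pi_iff.1 (h.model.measurable_feature a)
  have := h.measurable_policyAt
  fun_prop

lemma measurable_entropy_iterateAt :
    Measurable fun p : ((Fin d → ℝ) × ℝ × (Fin d → ℝ)) × 𝒳 => entropy (R.iterateAt p.1 p.2) := by
  have := h.measurable_iterateAt
  unfold entropy
  fun_prop

lemma thetaHat_eq {t : ℕ} (ht : t < T) (ω : Ω) (i : Fin d) :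
    R.thetaHat t ω i = R.loss t ω (R.A t ω) (R.X t ω) *
      ∑ j, R.precAt (R.param t ω) i j * R.φ (R.A t ω) (R.X t ω) j := by
  rw [thetaHat, h.cov_inv_eq ht, mulVec_smul, Pi.smul_apply, smul_eq_mul]
  rfl

lemma measurable_thetaHat_of_param {t : ℕ} (ht : t < T)
    (hp : Measurable[ℱ (t + 1)] (R.param t)) : Measurable[ℱ (t + 1)] (R.thetaHat t) := by
  -- There are finitely many arms, so joint measurability in arm and context can be checked arm by
  -- arm.
  have hφ := fun j => measurable_from_prod_countable_right
    (f := fun p : Fin K × 𝒳 => R.φ p.1 p.2 j)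
    fun a => measurable_pi_iff.1 (h.model.measurable_feature a) j
  refine @measurable_pi_lambda _ _ _ (ℱ (t + 1)) _ _ fun i => ?_
  simp_rw [h.thetaHat_eq ht]
  have h2 : ∀ j, Measurable[ℱ (t + 1)] fun ω =>
      R.precAt (R.param t ω) i j * R.φ (R.A t ω) (R.X t ω) j := by
    intro j
    have h3 := measurable_comp_pair (hφ j) (h.adversarial.adapted_action t ht)
      (h.adversarial.adapted_context t ht)
    exact Measurable.mul ((h.measurable_precAt i j).comp hp) h3
  exact (h.adversarial.adapted_loss t ht).mul (Finset.measurable_sum _ fun j _ => h2 j)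

/-- The state of the algorithm before round `t` is determined by the past. -/
lemma measurable_param {t : ℕ} (ht : t < T) : Measurable[ℱ t] (R.param t) := by
  -- The induction carries the entropy sum because the next learning rate reads it. That sum
  -- involves only contexts of earlier rounds, so the rate is predictable.
  have key : ∀ t, t < T → Measurable[ℱ t] (R.param t) ∧ Measurable[ℱ t] fun ω =>
      ∑ s ∈ Finset.range t, entropy (R.q s ω (R.X s ω)) := by
    intro t
    induction t with
    | zero =>
      intro ht
      refine ⟨?_, by simp⟩
      have h1 := h.adversarial.predictable_parameter 0 ht
      have h2 : R.param 0 = fun ω => ((0 : Fin d → ℝ), R.invEtaFirst, R.θ 0 ω) := by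
        funext ω
        simp [param, cumTheta, invEta]
      rw [h2]
      exact Measurable.prodMk (@measurable_const _ _ _ (ℱ 0) _)
        (Measurable.prodMk (@measurable_const _ _ _ (ℱ 0) _) h1)
    | succ t ih =>
      intro ht
      have ht' : t < T := by omega
      have hle : ℱ t ≤ ℱ (t + 1) := ℱ.mono (Nat.le_succ t)
      obtain ⟨ih1, ih2⟩ := ih ht'
      replace ih1 := ih1.mono hle le_rfl
      replace ih2 := ih2.mono hle le_rfl
      have hX := h.adversarial.adapted_context t ht'
      have hθ := h.adversarial.predictable_parameter (t + 1) ht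
      have hH : Measurable[ℱ (t + 1)] fun ω => entropy (R.q t ω (R.X t ω)) := by
        simp_rw [h.q_eq ht']
        have := measurable_comp_pair h.measurable_entropy_iterateAt ih1 hX
        exact this
      have hsum : Measurable[ℱ (t + 1)] fun ω =>
          ∑ s ∈ Finset.range (t + 1), entropy (R.q s ω (R.X s ω)) := by
        simp_rw [Finset.sum_range_succ]
        exact ih2.add hH
      refine ⟨Measurable.prodMk ?_ (Measurable.prodMk ?_ hθ), hsum⟩
      · have h1 : R.cumTheta (t + 1) = fun ω => (R.param t ω).1 + R.thetaHat t ω := by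
          funext ω
          exact Finset.sum_range_succ _ _
        change Measurable[ℱ (t + 1)] (R.cumTheta (t + 1))
        rw [h1]
        exact (measurable_fst.comp ih1).add (h.measurable_thetaHat_of_param ht' ih1)
      · have h2 : Measurable[ℱ (t + 1)] fun ω => R.invEta ω t :=
          measurable_fst.comp (measurable_snd.comp ih1)
        simp only [invEta]
        have h3 : Measurable fun p : ℝ × ℝ =>
            p.1 + R.invEtaFirst * (1 / √(1 + (Real.log K)⁻¹ * p.2)) := by fun_prop
        exact measurable_comp_pair h3 h2 hsum
  exact (key t ht).1

end IsSetting

end Run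

namespace Run

open Matrix

variable {K d T : ℕ} {𝒳 Ω : Type*} [MeasurableSpace 𝒳] {R : Run K d T 𝒳 Ω}

lemma gammaAt_param_inv (t : ℕ) (ω : Ω) :
    (R.gammaAt (R.param t ω))⁻¹ = R.lam * R.invEta ω t := by
  simp [gammaAt, param]

namespace IsSetting

variable [mΩ : MeasurableSpace Ω] {μ : Measure Ω} {ℱ : Filtration ℕ mΩ}
  {Z Θ : Set (Fin d → ℝ)} (h : R.IsSetting μ ℱ Z Θ)

include h

/-! ### Bounds on learning rates and inverse covariances. -/

section Bounds

lemma measurable_param' {t : ℕ} (ht : t < T) : Measurable (R.param t) :=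
  (h.measurable_param ht).mono (ℱ.le t) le_rfl

lemma measurable_context {t : ℕ} (ht : t < T) : Measurable (R.X t) :=
  (h.adversarial.adapted_context t ht).mono (ℱ.le (t + 1)) le_rfl

lemma measurable_action {t : ℕ} (ht : t < T) : Measurable (R.A t) :=
  (h.adversarial.adapted_action t ht).mono (ℱ.le (t + 1)) le_rfl

lemma measurable_loss {t : ℕ} (ht : t < T) :
    Measurable fun ω => R.loss t ω (R.A t ω) (R.X t ω) :=
  (h.adversarial.adapted_loss t ht).mono (ℱ.le (t + 1)) le_rfl

lemma q_mem {t : ℕ} (ht : t < T) (ω : Ω) (x : 𝒳) : R.q t ω x ∈ stdSimplex ℝ (Fin K) := by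
  rw [h.q_eq ht]
  exact h.iterateAt_mem _ _

lemma sum_entropy_nonneg {t : ℕ} (ht : t ≤ T) (ω : Ω) :
    0 ≤ ∑ s ∈ Finset.range t, entropy (R.q s ω (R.X s ω)) :=
  Finset.sum_nonneg fun _ hs => entropy_nonneg (h.q_mem ((Finset.mem_range.1 hs).trans_le ht) _ _)

/-- A crude bound that serves only integrability. -/
lemma invEta_le {t : ℕ} (ht : t < T) (ω : Ω) : R.invEta ω t ≤ ((t : ℝ) + 1) * R.invEtaFirst := by
  induction t with
  | zero => simp [invEta]
  | succ t ih =>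
    have h1 := ih (by omega)
    have h2 := h.sum_entropy_nonneg (t := t + 1) (by omega) ω
    have h3 := h.log_arms_pos
    have h4 : 1 / √(1 + (Real.log K)⁻¹ * ∑ s ∈ Finset.range (t + 1),
        entropy (R.q s ω (R.X s ω))) ≤ 1 := by
      rw [div_le_one (Real.sqrt_pos.2 (by positivity)), Real.one_le_sqrt]
      have := mul_nonneg (inv_nonneg.2 h3.le) h2
      linarith
    have h5 := mul_le_mul_of_nonneg_left h4 h.invEtaFirst_pos.le
    rw [invEta]
    push_cast
    linarith

/-- Entropies are at most `log K`, so the increment leading to index `t + 1` is at least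
`invEtaFirst / √(t + 2)`, which dominates the increment of the square root. -/
lemma le_invEta {t : ℕ} (ht : t < T) (ω : Ω) : R.invEtaFirst * √((t : ℝ) + 1) ≤ R.invEta ω t := by
  induction t with
  | zero => simp [invEta]
  | succ t ih =>
    have h1 := ih (by omega)
    have h2 := h.sum_entropy_nonneg (t := t + 1) (by omega) ω
    have h3 := h.log_arms_pos
    have h6 : (Real.log K)⁻¹ * ∑ s ∈ Finset.range (t + 1), entropy (R.q s ω (R.X s ω)) ≤
        t + 1 := by
      rw [inv_mul_le_iff₀ h3]
      calc ∑ s ∈ Finset.range (t + 1), entropy (R.q s ω (R.X s ω))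
          ≤ ∑ s ∈ Finset.range (t + 1), Real.log K := Finset.sum_le_sum fun s hs =>
            entropy_le_log h.arms_pos (h.q_mem (by have := Finset.mem_range.1 hs; omega) _ _)
        _ = Real.log K * (t + 1) := by simp [mul_comm]
    have h7 := mul_nonneg (inv_nonneg.2 h3.le) h2
    have h4 : 1 / √((t : ℝ) + 1 + 1) ≤ 1 / √(1 + (Real.log K)⁻¹ *
        ∑ s ∈ Finset.range (t + 1), entropy (R.q s ω (R.X s ω))) := by
      refine one_div_le_one_div_of_le (Real.sqrt_pos.2 (by linarith)) (Real.sqrt_le_sqrt ?_)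
      linarith
    have h5 : √((t : ℝ) + 1 + 1) ≤ √((t : ℝ) + 1) + 1 / √((t : ℝ) + 1 + 1) := by
      have hu : 0 < √((t : ℝ) + 1 + 1) := Real.sqrt_pos.2 (by positivity)
      have hv : 0 ≤ √((t : ℝ) + 1) := Real.sqrt_nonneg _
      have hu2 : √((t : ℝ) + 1 + 1) ^ 2 = t + 1 + 1 := Real.sq_sqrt (by positivity)
      have hv2 : √((t : ℝ) + 1) ^ 2 = t + 1 := Real.sq_sqrt (by positivity)
      have huv : √((t : ℝ) + 1) ≤ √((t : ℝ) + 1 + 1) := Real.sqrt_le_sqrt (by linarith)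
      rw [← sub_le_iff_le_add', le_div_iff₀ hu]
      nlinarith
    have h8 := mul_le_mul_of_nonneg_left (h5.trans (add_le_add_right h4 _)) h.invEtaFirst_pos.le
    rw [invEta]
    push_cast
    linarith

lemma isBdd_invEta {t : ℕ} (ht : t < T) : IsBdd fun ω => R.invEta ω t :=
  IsBdd.of_mem_Icc fun ω => ⟨(h.invEta_pos ω t).le, h.invEta_le ht ω⟩

lemma isBdd_one_div_invEta (t : ℕ) : IsBdd fun ω => 1 / R.invEta ω t :=
  IsBdd.of_mem_Icc fun ω => ⟨(one_div_pos.2 (h.invEta_pos ω t)).le,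
    one_div_le_one_div_of_le h.invEtaFirst_pos (h.invEtaFirst_le ω t)⟩

lemma measurable_invEta {t : ℕ} (ht : t < T) : Measurable fun ω => R.invEta ω t :=
  measurable_fst.comp (measurable_snd.comp (h.measurable_param' ht))

lemma isBdd_feature (a : Fin K) (i : Fin d) : IsBdd fun x => R.φ a x i := by
  have := h.model.isProbabilityMeasure
  exact h.exploration.isBdd_feature h.model.feature_mem a i

lemma measurable_iterateAt_right (s : (Fin d → ℝ) × ℝ × (Fin d → ℝ)) (a : Fin K) :
    Measurable fun x => R.iterateAt s x a :=
  measurable_comp_pair (h.measurable_iterateAt a) (U := fun _ => s) (X := fun x => x)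
    measurable_const measurable_id

lemma measurable_policyAt_right (s : (Fin d → ℝ) × ℝ × (Fin d → ℝ)) (a : Fin K) :
    Measurable fun x => R.policyAt s x a :=
  measurable_comp_pair (h.measurable_policyAt a) (U := fun _ => s) (X := fun x => x)
    measurable_const measurable_id

lemma covMatrix_policyAt_posDef (t : ℕ) (ω : Ω) :
    (covMatrix R.G R.φ (R.policyAt (R.param t ω))).PosDef := by
  have := h.model.isProbabilityMeasure
  exact covMatrix_mix_posDef h.exploration h.model.measurable_feature h.model.feature_mem
    (h.measurable_iterateAt_right _) (h.iterateAt_mem _) (h.gammaAt_pos t ω) (h.gammaAt_le_one t ω)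

lemma precAt_posDef (t : ℕ) (ω : Ω) : (R.precAt (R.param t ω)).PosDef :=
  (h.covMatrix_policyAt_posDef t ω).inv

lemma quadForm_precAt_le (t : ℕ) (ω : Ω) (w : Fin d → ℝ) :
    w ⬝ᵥ R.precAt (R.param t ω) *ᵥ w ≤
      R.lam * R.invEta ω t * (w ⬝ᵥ (covMatrix R.G R.φ R.e)⁻¹ *ᵥ w) := by
  have := h.model.isProbabilityMeasure
  rw [← gammaAt_param_inv]
  exact covMatrix_mix_inv_le h.exploration h.model.measurable_feature h.model.feature_mem
    (h.measurable_iterateAt_right _) (h.iterateAt_mem _) (h.gammaAt_pos t ω)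
    (h.gammaAt_le_one t ω) w

/-- The reason for the choice `γ_t = η_t / λ`: the factors `λ` and `1 / λ` cancel. -/
lemma quadForm_precAt_feature_le (t : ℕ) (ω : Ω) (a : Fin K) (x : 𝒳) :
    R.φ a x ⬝ᵥ R.precAt (R.param t ω) *ᵥ R.φ a x ≤ R.invEta ω t := by
  have h1 := h.lam_pos
  have h2 := h.invEta_pos ω t
  refine (h.quadForm_precAt_le t ω _).trans ?_
  calc R.lam * R.invEta ω t * (R.φ a x ⬝ᵥ (covMatrix R.G R.φ R.e)⁻¹ *ᵥ R.φ a x)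
      ≤ R.lam * R.invEta ω t * (1 / R.lam) := mul_le_mul_of_nonneg_left
        (h.exploration.quadForm_le _ (h.model.feature_mem a x)) (by positivity)
    _ = R.invEta ω t := by field_simp

/-- Cauchy–Schwarz. With losses bounded by one, this is the size condition on estimated losses in
`ftrl_regret_le`. -/
lemma abs_precAt_feature_le (t : ℕ) (ω : Ω) (a b : Fin K) (x y : 𝒳) :
    |R.φ a x ⬝ᵥ R.precAt (R.param t ω) *ᵥ R.φ b y| ≤ R.invEta ω t := by
  have hP := (h.precAt_posDef t ω).posSemidef
  have h0 := hP.dotProduct_mulVec_nonneg (R.φ b y)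
  rw [star_trivial] at h0
  refine abs_le_of_sq_le_sq ((dotProduct_mulVec_sq_le hP _ _).trans ?_) (h.invEta_pos ω t).le
  rw [sq]
  exact mul_le_mul (h.quadForm_precAt_feature_le t ω a x) (h.quadForm_precAt_feature_le t ω b y)
    h0 (h.invEta_pos ω t).le

/-- Diagonal entries are controlled by `Σ(e)⁻¹` and the bound on `invEta`, off-diagonal ones by
Cauchy–Schwarz. -/
lemma isBdd_precAt {t : ℕ} (ht : t < T) (i j : Fin d) :
    IsBdd fun ω => R.precAt (R.param t ω) i j := by
  have hc : ∀ i : Fin d, IsBdd fun ω =>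
      (Pi.single i (1 : ℝ)) ⬝ᵥ R.precAt (R.param t ω) *ᵥ (Pi.single i 1) := by
    intro i
    have hC := (((IsBdd.const R.lam).mul (h.isBdd_invEta ht)).mul
      (IsBdd.const ((Pi.single i (1 : ℝ)) ⬝ᵥ (covMatrix R.G R.φ R.e)⁻¹ *ᵥ (Pi.single i 1))))
    obtain ⟨C, hC⟩ := hC
    refine ⟨C, fun ω => ?_⟩
    have h0 := (h.precAt_posDef t ω).posSemidef.dotProduct_mulVec_nonneg (Pi.single i (1 : ℝ))
    rw [star_trivial] at h0
    rw [abs_of_nonneg h0]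
    exact (h.quadForm_precAt_le t ω _).trans ((le_abs_self _).trans (hC ω))
  obtain ⟨C, hC⟩ := (hc i).mul (hc j)
  refine IsBdd.of_sq_le (C := C) fun ω => ?_
  have h1 := dotProduct_mulVec_sq_le (h.precAt_posDef t ω).posSemidef (Pi.single i (1 : ℝ))
    (Pi.single j 1)
  have h2 : (Pi.single i (1 : ℝ)) ⬝ᵥ R.precAt (R.param t ω) *ᵥ (Pi.single j 1) =
      R.precAt (R.param t ω) i j := by
    rw [single_one_dotProduct, mulVec_single_one, col_apply]
  rw [h2] at h1
  exact h1.trans ((le_abs_self _).trans (hC ω))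

lemma abs_feature_dotProduct_le {t : ℕ} (ht : t < T) (ω : Ω) (a : Fin K) (x : 𝒳) :
    |R.φ a x ⬝ᵥ R.θ t ω| ≤ 1 :=
  h.bounded.inner_le _ (h.model.feature_mem a x) _ (h.adversarial.parameter_mem t ht ω)

lemma measurable_feature_pi (a : Fin K) (i : Fin d) : Measurable fun x => R.φ a x i :=
  measurable_pi_iff.1 (h.model.measurable_feature a) i

end Bounds

/-! ### Averaging over context, action and noise. -/

section Expectations

/-- Averaging over the context of round `t`. -/
lemma integral_context [IsProbabilityMeasure μ] {S : Type*} [MeasurableSpace S] {t : ℕ} (ht : t < T) {U : Ω → S}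
    (hU : Measurable[ℱ t] U) {f : S × 𝒳 → ℝ} (hf : Measurable f)
    (hb : IsBdd fun p : Ω × 𝒳 => f (U p.1, p.2)) :
    ∫ ω, f (U ω, R.X t ω) ∂μ = ∫ ω, ∫ x, f (U ω, x) ∂ R.G ∂μ :=
  integral_of_indep (ℱ.le t) (h.measurable_context ht) (h.adversarial.context_law t ht)
    (h.adversarial.context_indep t ht) hU hf hb

lemma context_le {t : ℕ} (ht : t < T) :
    ℱ t ⊔ MeasurableSpace.comap (R.X t) inferInstance ≤ mΩ :=
  sup_le (ℱ.le t) (h.measurable_context ht).comap_le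

lemma noise_le {t : ℕ} (ht : t < T) :
    ℱ t ⊔ MeasurableSpace.comap (R.X t) inferInstance
      ⊔ MeasurableSpace.comap (R.ε t) inferInstance ≤ mΩ :=
  sup_le (h.context_le ht) (h.adversarial.measurable_noise t ht).comap_le

lemma measurable_param_context {t : ℕ} (ht : t < T)
    {f : ((Fin d → ℝ) × ℝ × (Fin d → ℝ)) × 𝒳 → ℝ} (hf : Measurable f) :
    Measurable[ℱ t ⊔ MeasurableSpace.comap (R.X t) inferInstance]
      fun ω => f (R.param t ω, R.X t ω) :=
  measurable_comp_pair hf ((h.measurable_param ht).mono le_sup_left le_rfl)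
    ((comap_measurable (R.X t)).mono le_sup_right le_rfl)

lemma measurable_loss_arm {t : ℕ} (ht : t < T) (a : Fin K) :
    Measurable[ℱ t ⊔ MeasurableSpace.comap (R.X t) inferInstance
      ⊔ MeasurableSpace.comap (R.ε t) inferInstance] fun ω => R.loss t ω a (R.X t ω) := by
  have h1 : Measurable fun p : ((Fin d → ℝ) × ℝ × (Fin d → ℝ)) × 𝒳 => R.φ a p.2 ⬝ᵥ p.1.2.2 := by
    have := h.measurable_feature_pi a
    unfold dotProduct
    fun_prop
  have h2 := (h.measurable_param_context ht h1).mono (le_sup_left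
    (b := MeasurableSpace.comap (R.ε t) inferInstance)) le_rfl
  have h3 : Measurable[ℱ t ⊔ MeasurableSpace.comap (R.X t) inferInstance
      ⊔ MeasurableSpace.comap (R.ε t) inferInstance] fun ω => R.ε t ω a :=
    (measurable_pi_apply a).comp ((comap_measurable (R.ε t)).mono le_sup_right le_rfl)
  exact h2.add h3

lemma integrable_loss_arm [IsProbabilityMeasure μ] {t : ℕ} (ht : t < T) (a : Fin K) :
    Integrable (fun ω => R.loss t ω a (R.X t ω)) μ := by
  refine Integrable.of_bound
    ((h.measurable_loss_arm ht a).mono (h.noise_le ht) le_rfl).aestronglyMeasurable 1 ?_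
  filter_upwards [h.bounded.loss_le t ht] with ω hω using hω a _

lemma abs_policy_le_one {t : ℕ} (ht : t < T) (ω : Ω) (x : 𝒳) (a : Fin K) :
    |R.policy t ω x a| ≤ 1 := by
  have h1 := h.policyAt_mem t ω x
  rw [h.policy_eq ht, abs_of_nonneg (h1.1 a), ← h1.2]
  exact Finset.single_le_sum (fun i _ => h1.1 i) (Finset.mem_univ a)

/-- Averaging over the action of round `t`. -/
lemma integral_action [IsProbabilityMeasure μ] {t : ℕ} (ht : t < T) {f : Fin K → Ω → ℝ}
    (hf : ∀ a, Measurable[ℱ t ⊔ MeasurableSpace.comap (R.X t) inferInstance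
      ⊔ MeasurableSpace.comap (R.ε t) inferInstance] (f a))
    {c : ℝ} (hc : ∀ a, ∀ᵐ ω ∂μ, |f a ω| ≤ c) :
    ∫ ω, f (R.A t ω) ω ∂μ = ∫ ω, ∑ a, R.policy t ω (R.X t ω) a * f a ω ∂μ := by
  have hm := h.noise_le ht
  have hind : ∀ a, Integrable (Set.indicator {ω | R.A t ω = a} (fun _ => (1 : ℝ))) μ := fun a =>
    (integrable_const (1 : ℝ)).indicator (h.measurable_action ht (measurableSet_singleton a))
  have hfm : ∀ a, Measurable (f a) := fun a => (hf a).mono hm le_rfl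
  have hpm : ∀ a, Measurable fun ω => R.policy t ω (R.X t ω) a := by
    intro a
    simp_rw [h.policy_eq ht]
    exact measurable_comp_pair (h.measurable_policyAt a) (h.measurable_param' ht)
      (h.measurable_context ht)
  have e1 : ∀ ω, f (R.A t ω) ω =
      ∑ a, f a ω * Set.indicator {ω | R.A t ω = a} (fun _ => (1 : ℝ)) ω := by
    intro ω
    simp [Set.indicator_apply]
  simp_rw [e1]
  have hi1 : ∀ a ∈ Finset.univ, Integrable
      (fun ω => f a ω * Set.indicator {ω | R.A t ω = a} (fun _ => (1 : ℝ)) ω) μ := by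
    intro a _
    exact (hind a).bdd_mul (c := c) (hfm a).aestronglyMeasurable (hc a)
  have hi2 : ∀ a ∈ Finset.univ, Integrable
      (fun ω => R.policy t ω (R.X t ω) a * f a ω) μ := by
    intro a _
    refine Integrable.bdd_mul (c := 1)
      (Integrable.of_bound (hfm a).aestronglyMeasurable c (hc a)) (hpm a).aestronglyMeasurable ?_
    exact Filter.Eventually.of_forall fun ω => h.abs_policy_le_one ht ω _ a
  rw [integral_finsetSum _ hi1, integral_finsetSum _ hi2]
  refine Finset.sum_congr rfl fun a _ => ?_
  rw [integral_mul_of_condExp hm (hf a) (hc a) (hind a) (h.adversarial.action_law t ht a)]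
  simp_rw [mul_comm]

/-- Averaging a weighted sum of the losses over the noise and the context of round `t`. -/
lemma integral_weighted_loss [IsProbabilityMeasure μ] {t : ℕ} (ht : t < T)
    {g : ((Fin d → ℝ) × ℝ × (Fin d → ℝ)) → 𝒳 → Fin K → ℝ}
    (hg : ∀ a, Measurable fun p : ((Fin d → ℝ) × ℝ × (Fin d → ℝ)) × 𝒳 => g p.1 p.2 a)
    (hb : ∀ a, IsBdd fun p : Ω × 𝒳 => g (R.param t p.1) p.2 a) :
    ∫ ω, ∑ a, g (R.param t ω) (R.X t ω) a * R.loss t ω a (R.X t ω) ∂μ =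
      ∫ ω, ∫ x, ∑ a, g (R.param t ω) x a * (R.φ a x ⬝ᵥ R.θ t ω) ∂ R.G ∂μ := by
  have hφθ : ∀ a, Measurable fun p : ((Fin d → ℝ) × ℝ × (Fin d → ℝ)) × 𝒳 =>
      R.φ a p.2 ⬝ᵥ p.1.2.2 := by
    intro a
    have := h.measurable_feature_pi a
    unfold dotProduct
    fun_prop
  have hbφ : ∀ a, IsBdd fun p : Ω × 𝒳 => R.φ a p.2 ⬝ᵥ R.θ t p.1 := fun a =>
    ⟨1, fun p => h.abs_feature_dotProduct_le ht p.1 a p.2⟩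
  have hF : Measurable fun p : ((Fin d → ℝ) × ℝ × (Fin d → ℝ)) × 𝒳 =>
      ∑ a, g p.1 p.2 a * (R.φ a p.2 ⬝ᵥ p.1.2.2) := by fun_prop
  have hFb : IsBdd fun p : Ω × 𝒳 =>
      ∑ a, g (R.param t p.1) p.2 a * (R.φ a p.2 ⬝ᵥ R.θ t p.1) :=
    IsBdd.sum fun a _ => (hb a).mul (hbφ a)
  refine Eq.trans ?_ (h.integral_context ht (h.measurable_param ht) hF hFb)
  have hUX := (h.measurable_param' ht).prodMk (h.measurable_context ht)
  -- Integrability of the noise has to be derived, as loss minus linear part: the conditional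
  -- expectation of a non-integrable function is zero by convention, and centring would then carry
  -- no information.
  have hεi : ∀ a, Integrable (fun ω => R.ε t ω a) μ := by
    intro a
    have h2 : Integrable (fun ω => R.φ a (R.X t ω) ⬝ᵥ R.θ t ω) μ :=
      ((hbφ a).comp fun ω => (ω, R.X t ω)).integrable ((hφθ a).comp hUX)
    refine ((h.integrable_loss_arm ht a).sub h2).congr (Filter.Eventually.of_forall fun ω => ?_)
    simp [loss]
  have hgi : ∀ a, Integrable (fun ω => g (R.param t ω) (R.X t ω) a * R.ε t ω a) μ := by
    intro a
    obtain ⟨c, hc⟩ := hb a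
    exact (hεi a).bdd_mul (c := c) ((hg a).comp hUX).aestronglyMeasurable
      (Filter.Eventually.of_forall fun ω => hc (ω, R.X t ω))
  have hz : ∀ a, ∫ ω, g (R.param t ω) (R.X t ω) a * R.ε t ω a ∂μ = 0 := by
    intro a
    obtain ⟨c, hc⟩ := hb a
    rw [integral_mul_of_condExp (h.context_le ht) (h.measurable_param_context ht (hg a))
      (Filter.Eventually.of_forall fun ω => hc (ω, R.X t ω)) (hεi a)
      (h.adversarial.noise_centred t ht a)]
    simp
  have hsplit : ∀ ω, ∑ a, g (R.param t ω) (R.X t ω) a * R.loss t ω a (R.X t ω) =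
      ∑ a, g (R.param t ω) (R.X t ω) a * (R.φ a (R.X t ω) ⬝ᵥ R.θ t ω) +
        ∑ a, g (R.param t ω) (R.X t ω) a * R.ε t ω a := by
    intro ω
    simp only [loss, mul_add, Finset.sum_add_distrib]
  simp_rw [hsplit]
  rw [integral_add ((hFb.comp fun ω => (ω, R.X t ω)).integrable (hF.comp hUX))
    (integrable_finsetSum _ fun a _ => hgi a), integral_finsetSum _ fun a _ => hgi a]
  simp_rw [hz]
  rw [Finset.sum_const_zero, add_zero]
  rfl

end Expectations

end IsSetting

end Run

lemma sum_sum_mul_eq_trace {d : ℕ} (N S : Matrix (Fin d) (Fin d) ℝ) (hS : S.IsHermitian) :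
    ∑ i, ∑ j, N i j * S i j = (N * S).trace := by
  rw [Matrix.trace]
  refine Finset.sum_congr rfl fun i _ => ?_
  rw [Matrix.diag_apply, Matrix.mul_apply]
  refine Finset.sum_congr rfl fun j _ => ?_
  have := hS.apply i j
  rw [star_trivial] at this
  rw [this]

namespace Run

open Matrix

variable {K d T : ℕ} {𝒳 Ω : Type*} [MeasurableSpace 𝒳] {R : Run K d T 𝒳 Ω}

/-- The mean difference of the features chosen by the iterate and by a comparator. -/
def gapVec (R : Run K d T 𝒳 Ω) (ρ : 𝒳 → Fin K) (s : (Fin d → ℝ) × ℝ × (Fin d → ℝ))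
    (i : Fin d) : ℝ :=
  ∫ x, ∑ a, (R.iterateAt s x a - if ρ x = a then 1 else 0) * R.φ a x i ∂ R.G

/-- The matrix `Σ(π)⁻¹ Σ(q) Σ(π)⁻¹`. -/
def secondMoment (R : Run K d T 𝒳 Ω) (s : (Fin d → ℝ) × ℝ × (Fin d → ℝ)) :
    Matrix (Fin d) (Fin d) ℝ :=
  R.precAt s * covMatrix R.G R.φ (R.iterateAt s) * R.precAt s

namespace IsSetting

variable [mΩ : MeasurableSpace Ω] {μ : Measure Ω} {ℱ : Filtration ℕ mΩ}
  {Z Θ : Set (Fin d → ℝ)} (h : R.IsSetting μ ℱ Z Θ)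

include h

/-! ### Algebra of the estimator for a fixed past. -/

section Deterministic

lemma measurable_thetaHat {t : ℕ} (ht : t < T) : Measurable (R.thetaHat t) :=
  (h.measurable_thetaHat_of_param ht
    ((h.measurable_param ht).mono (ℱ.mono (Nat.le_succ t)) le_rfl)).mono (ℱ.le (t + 1)) le_rfl

lemma thetaHat_eq_smul {t : ℕ} (ht : t < T) (ω : Ω) :
    R.thetaHat t ω = R.loss t ω (R.A t ω) (R.X t ω) •
      R.precAt (R.param t ω) *ᵥ R.φ (R.A t ω) (R.X t ω) := by
  rw [thetaHat, h.cov_inv_eq ht, mulVec_smul]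

lemma isBdd_iterateAt (a : Fin K) :
    IsBdd fun p : ((Fin d → ℝ) × ℝ × (Fin d → ℝ)) × 𝒳 => R.iterateAt p.1 p.2 a :=
  isBdd_of_mem_stdSimplex (p := fun p : ((Fin d → ℝ) × ℝ × (Fin d → ℝ)) × 𝒳 =>
    R.iterateAt p.1 p.2) (fun p => h.iterateAt_mem p.1 p.2) a

variable {ρ : 𝒳 → Fin K}

lemma isBdd_gap (a : Fin K) : IsBdd fun p : ((Fin d → ℝ) × ℝ × (Fin d → ℝ)) × 𝒳 =>
    R.iterateAt p.1 p.2 a - if ρ p.2 = a then 1 else 0 := by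
  refine (h.isBdd_iterateAt a).sub (IsBdd.of_mem_Icc (a := 0) (b := 1) fun p => ?_)
  split_ifs <;> simp

lemma measurable_gap (hρ : Measurable ρ) (a : Fin K) :
    Measurable fun p : ((Fin d → ℝ) × ℝ × (Fin d → ℝ)) × 𝒳 =>
      R.iterateAt p.1 p.2 a - if ρ p.2 = a then 1 else 0 :=
  (h.measurable_iterateAt a).sub (Measurable.ite
    ((hρ.comp measurable_snd) (measurableSet_singleton a)) measurable_const measurable_const)

lemma measurable_gapVec (hρ : Measurable ρ) : Measurable (R.gapVec ρ) := by
  have := h.model.isProbabilityMeasure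
  refine measurable_pi_lambda _ fun i => ?_
  refine (StronglyMeasurable.integral_prod_right' (ν := R.G)
    (f := fun p : ((Fin d → ℝ) × ℝ × (Fin d → ℝ)) × 𝒳 => ∑ a, (R.iterateAt p.1 p.2 a -
      if ρ p.2 = a then 1 else 0) * R.φ a p.2 i) (Measurable.stronglyMeasurable ?_)).measurable
  exact Finset.measurable_sum _ fun a _ =>
    (h.measurable_gap hρ a).mul ((h.measurable_feature_pi a i).comp measurable_snd)

lemma isBdd_gapVec (i : Fin d) : IsBdd fun s => R.gapVec ρ s i := by
  have := h.model.isProbabilityMeasure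
  exact IsBdd.integral (f := fun s x => ∑ a, (R.iterateAt s x a -
    if ρ x = a then 1 else 0) * R.φ a x i)
    (IsBdd.sum fun a _ => (h.isBdd_gap a).mul ((h.isBdd_feature a i).comp Prod.snd))

/-- Used with `w` equal to the true parameter and to its estimate: one predictable vector measures
both the true and the estimated linear regret. -/
lemma gapVec_dotProduct (hρ : Measurable ρ) (s : (Fin d → ℝ) × ℝ × (Fin d → ℝ))
    (w : Fin d → ℝ) :
    R.gapVec ρ s ⬝ᵥ w =
      ∫ x, ∑ a, (R.iterateAt s x a - if ρ x = a then 1 else 0) * (R.φ a x ⬝ᵥ w) ∂ R.G := by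
  have := h.model.isProbabilityMeasure
  have hi : ∀ i, Integrable (fun x => ∑ a, (R.iterateAt s x a -
      if ρ x = a then 1 else 0) * R.φ a x i) R.G := by
    intro i
    refine IsBdd.integrable (IsBdd.sum fun a _ => ((h.isBdd_gap a).comp fun x => (s, x)).mul
      (h.isBdd_feature a i)) ?_
    have h1 := fun a => measurable_comp_pair (h.measurable_gap hρ a) (U := fun _ : 𝒳 => s)
      (X := fun x => x) measurable_const measurable_id
    exact Finset.measurable_sum _ fun a _ => (h1 a).mul (h.measurable_feature_pi a i)
  have h2 : ∀ x, ∑ a, (R.iterateAt s x a - if ρ x = a then 1 else 0) * (R.φ a x ⬝ᵥ w) =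
      ∑ i, (∑ a, (R.iterateAt s x a - if ρ x = a then 1 else 0) * R.φ a x i) * w i := by
    intro x
    simp only [dotProduct, Finset.mul_sum, Finset.sum_mul]
    rw [Finset.sum_comm]
    exact Finset.sum_congr rfl fun i _ => Finset.sum_congr rfl fun a _ => by ring
  simp_rw [h2]
  rw [integral_finsetSum _ fun i _ => (hi i).mul_const (w i)]
  simp_rw [integral_mul_const]
  rfl

lemma measurable_covMatrix_iterateAt (i j : Fin d) :
    Measurable fun s => covMatrix R.G R.φ (R.iterateAt s) i j := by
  have := h.model.isProbabilityMeasure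
  refine (StronglyMeasurable.integral_prod_right' (ν := R.G)
    (f := fun p : ((Fin d → ℝ) × ℝ × (Fin d → ℝ)) × 𝒳 => ∑ a, R.iterateAt p.1 p.2 a *
      (R.φ a p.2 i * R.φ a p.2 j)) (Measurable.stronglyMeasurable ?_)).measurable
  have := fun a => measurable_pi_iff.1 (h.model.measurable_feature a)
  have := h.measurable_iterateAt
  fun_prop

lemma isBdd_covMatrix_iterateAt (i j : Fin d) :
    IsBdd fun s => covMatrix R.G R.φ (R.iterateAt s) i j := by
  have := h.model.isProbabilityMeasure
  exact IsBdd.integral (f := fun s x => ∑ a, R.iterateAt s x a * (R.φ a x i * R.φ a x j))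
    (IsBdd.sum fun a _ => (h.isBdd_iterateAt a).mul
      (((h.isBdd_feature a i).comp Prod.snd).mul ((h.isBdd_feature a j).comp Prod.snd)))

lemma covMatrix_iterateAt_posSemidef (s : (Fin d → ℝ) × ℝ × (Fin d → ℝ)) :
    (covMatrix R.G R.φ (R.iterateAt s)).PosSemidef := by
  have := h.model.isProbabilityMeasure
  exact covMatrix_posSemidef h.model.measurable_feature h.isBdd_feature
    (h.measurable_iterateAt_right s) (h.iterateAt_mem s)

lemma measurable_secondMoment (i j : Fin d) : Measurable fun s => R.secondMoment s i j := by
  have := h.measurable_precAt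
  have := h.measurable_covMatrix_iterateAt
  simp only [secondMoment, mul_apply]
  fun_prop

lemma isBdd_secondMoment {t : ℕ} (ht : t < T) (i j : Fin d) :
    IsBdd fun ω => R.secondMoment (R.param t ω) i j := by
  simp only [secondMoment, mul_apply]
  exact IsBdd.sum fun k _ => (IsBdd.sum fun l _ => (h.isBdd_precAt ht _ _).mul
    ((h.isBdd_covMatrix_iterateAt _ _).comp _)).mul (h.isBdd_precAt ht _ _)

lemma dotProduct_secondMoment (t : ℕ) (ω : Ω) (z : Fin d → ℝ) :
    z ⬝ᵥ R.secondMoment (R.param t ω) *ᵥ z =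
      (R.precAt (R.param t ω) *ᵥ z) ⬝ᵥ
        covMatrix R.G R.φ (R.iterateAt (R.param t ω)) *ᵥ (R.precAt (R.param t ω) *ᵥ z) := by
  rw [secondMoment, ← mulVec_mulVec, ← mulVec_mulVec,
    dotProduct_mulVec_swap (h.precAt_posDef t ω).isHermitian, dotProduct_comm]

lemma secondMoment_nonneg (t : ℕ) (ω : Ω) (z : Fin d → ℝ) :
    0 ≤ z ⬝ᵥ R.secondMoment (R.param t ω) *ᵥ z := by
  rw [h.dotProduct_secondMoment]
  simpa using (h.covMatrix_iterateAt_posSemidef (R.param t ω)).dotProduct_mulVec_nonneg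
    (R.precAt (R.param t ω) *ᵥ z)

lemma isUnit_det_covMatrix_policyAt (t : ℕ) (ω : Ω) :
    IsUnit (covMatrix R.G R.φ (R.policyAt (R.param t ω))).det :=
  (Matrix.isUnit_iff_isUnit_det _).1 (h.covMatrix_policyAt_posDef t ω).isUnit

/-- The second moment of the estimated losses under the policy. -/
lemma integral_secondMoment_le (t : ℕ) (ω : Ω) :
    ∫ x, ∑ a, R.policyAt (R.param t ω) x a *
      (R.φ a x ⬝ᵥ R.secondMoment (R.param t ω) *ᵥ R.φ a x) ∂ R.G ≤ 1 / R.lam + d := by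
  have := h.model.isProbabilityMeasure
  -- With `P = Σ(π)⁻¹`, the average is `tr(P Σ(q) P Σ(π)) = tr(P Σ(q))`, the trace bounded by
  -- `integral_quadForm_inv_le`.
  rw [← sum_mul_covMatrix h.model.measurable_feature h.isBdd_feature
    (h.measurable_policyAt_right _) (isBdd_of_mem_stdSimplex (h.policyAt_mem t ω)),
    sum_sum_mul_eq_trace _ _ (h.covMatrix_policyAt_posDef t ω).isHermitian, secondMoment,
    Matrix.mul_assoc]
  nth_rw 2 [precAt]
  rw [nonsing_inv_mul _ (h.isUnit_det_covMatrix_policyAt t ω), Matrix.mul_one,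
    ← sum_sum_mul_eq_trace _ _ (h.covMatrix_iterateAt_posSemidef _).isHermitian,
    sum_mul_covMatrix h.model.measurable_feature h.isBdd_feature
    (h.measurable_iterateAt_right _) (isBdd_of_mem_stdSimplex (h.iterateAt_mem _))]
  exact integral_quadForm_inv_le h.exploration h.model.measurable_feature h.model.feature_mem
    (h.measurable_iterateAt_right _) (h.iterateAt_mem _) (h.gammaAt_pos t ω) (h.gammaAt_le_one t ω)

/-- Conditionally on the past, the parameter estimate is unbiased. -/
lemma integral_policyAt_mul (t : ℕ) (ω : Ω) (w : Fin d → ℝ) :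
    ∫ x, ∑ a, R.policyAt (R.param t ω) x a *
      (w ⬝ᵥ R.precAt (R.param t ω) *ᵥ R.φ a x) * (R.φ a x ⬝ᵥ R.θ t ω) ∂ R.G =
      w ⬝ᵥ R.θ t ω := by
  have := h.model.isProbabilityMeasure
  have hP := (h.precAt_posDef t ω).isHermitian
  -- With `P = Σ(π)⁻¹` symmetric, `(P w)ᵀ Σ(π) θ = wᵀ θ`.
  have h1 := dotProduct_covMatrix_mulVec (G := R.G) h.model.measurable_feature h.isBdd_feature
    (h.measurable_policyAt_right (R.param t ω)) (isBdd_of_mem_stdSimplex (h.policyAt_mem t ω))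
    (R.precAt (R.param t ω) *ᵥ w) (R.θ t ω)
  rw [dotProduct_comm (R.precAt (R.param t ω) *ᵥ w), dotProduct_mulVec_swap hP, mulVec_mulVec]
    at h1
  nth_rw 1 [precAt] at h1
  rw [nonsing_inv_mul _ (h.isUnit_det_covMatrix_policyAt t ω), one_mulVec] at h1
  rw [h1]
  simp_rw [dotProduct_mulVec_swap hP w, dotProduct_comm _ (R.precAt (R.param t ω) *ᵥ w), mul_assoc]

/-- The estimated second moment of the losses of the iterate. -/
lemma integral_iterate_lossHat_sq {t : ℕ} (ht : t < T) (ω : Ω) :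
    ∫ x, ∑ a, R.q t ω x a * R.lossHat t ω x a ^ 2 ∂ R.G =
      R.loss t ω (R.A t ω) (R.X t ω) ^ 2 * (R.φ (R.A t ω) (R.X t ω) ⬝ᵥ
        R.secondMoment (R.param t ω) *ᵥ R.φ (R.A t ω) (R.X t ω)) := by
  have := h.model.isProbabilityMeasure
  have h1 := dotProduct_covMatrix_mulVec (G := R.G) h.model.measurable_feature h.isBdd_feature
    (h.measurable_iterateAt_right (R.param t ω)) (isBdd_of_mem_stdSimplex (h.iterateAt_mem _))
    (R.thetaHat t ω) (R.thetaHat t ω)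
  simp_rw [h.q_eq ht, lossHat, sq]
  simp_rw [dotProduct_comm _ (R.thetaHat t ω)] at h1
  rw [← h1, h.dotProduct_secondMoment, h.thetaHat_eq_smul ht]
  simp only [mulVec_smul, dotProduct_smul, smul_dotProduct, smul_eq_mul]
  ring

lemma measurable_quadForm_secondMoment (a : Fin K) :
    Measurable fun p : ((Fin d → ℝ) × ℝ × (Fin d → ℝ)) × 𝒳 =>
      1 / p.1.2.1 * (R.φ a p.2 ⬝ᵥ R.secondMoment p.1 *ᵥ R.φ a p.2) := by
  have := h.measurable_feature_pi a
  have := h.measurable_secondMoment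
  unfold dotProduct mulVec dotProduct
  fun_prop

lemma isBdd_quadForm_secondMoment {t : ℕ} (ht : t < T) (a : Fin K) :
    IsBdd fun p : Ω × 𝒳 => 1 / (R.param t p.1).2.1 *
      (R.φ a p.2 ⬝ᵥ R.secondMoment (R.param t p.1) *ᵥ R.φ a p.2) := by
  unfold dotProduct mulVec dotProduct
  exact ((h.isBdd_one_div_invEta t).comp Prod.fst).mul
    (IsBdd.sum fun i _ => ((h.isBdd_feature a i).comp Prod.snd).mul
      (IsBdd.sum fun j _ => ((h.isBdd_secondMoment ht i j).comp Prod.fst).mul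
        ((h.isBdd_feature a j).comp Prod.snd)))

lemma isBdd_gapVec_precAt {t : ℕ} (ht : t < T) (a : Fin K) : IsBdd fun p : Ω × 𝒳 =>
    R.gapVec ρ (R.param t p.1) ⬝ᵥ R.precAt (R.param t p.1) *ᵥ R.φ a p.2 := by
  unfold dotProduct mulVec dotProduct
  exact IsBdd.sum fun i _ => ((h.isBdd_gapVec i).comp fun p : Ω × 𝒳 => R.param t p.1).mul
    (IsBdd.sum fun j _ => ((h.isBdd_precAt ht i j).comp Prod.fst).mul
      ((h.isBdd_feature a j).comp Prod.snd))

end Deterministic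

/-! ### First and second moments of the estimator. -/

section Moments

variable [IsProbabilityMeasure μ] {ρ : 𝒳 → Fin K}

/-- The expected estimated regret of a round is the expected linear regret of the iterate. -/
lemma integral_thetaHat_dotProduct (hρ : Measurable ρ) {t : ℕ} (ht : t < T) :
    ∫ ω, R.gapVec ρ (R.param t ω) ⬝ᵥ R.thetaHat t ω ∂μ =
      ∫ ω, R.gapVec ρ (R.param t ω) ⬝ᵥ R.θ t ω ∂μ := by
  have hgm : ∀ a, Measurable fun p : ((Fin d → ℝ) × ℝ × (Fin d → ℝ)) × 𝒳 =>
      R.gapVec ρ p.1 ⬝ᵥ R.precAt p.1 *ᵥ R.φ a p.2 := by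
    intro a
    have := h.measurable_feature_pi a
    have := h.measurable_precAt
    have := measurable_pi_iff.1 (h.measurable_gapVec hρ)
    unfold dotProduct mulVec dotProduct
    fun_prop
  have hgb := h.isBdd_gapVec_precAt (ρ := ρ) ht
  choose C hC using hgb
  have e1 : ∀ ω, R.gapVec ρ (R.param t ω) ⬝ᵥ R.thetaHat t ω =
      (fun a ω => (R.gapVec ρ (R.param t ω) ⬝ᵥ R.precAt (R.param t ω) *ᵥ R.φ a (R.X t ω)) *
        R.loss t ω a (R.X t ω)) (R.A t ω) ω := by
    intro ω
    rw [h.thetaHat_eq_smul ht, dotProduct_smul, smul_eq_mul, mul_comm]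
  simp_rw [e1]
  -- Averaging the action produces the weights `π`, averaging noise and context replaces the loss by
  -- `φᵀ θ`, and unbiasedness leaves `θ`.
  rw [h.integral_action ht (f := fun a ω =>
    (R.gapVec ρ (R.param t ω) ⬝ᵥ R.precAt (R.param t ω) *ᵥ R.φ a (R.X t ω)) *
        R.loss t ω a (R.X t ω)) (c := ∑ a, |C a|) ?_ ?_]
  · simp_rw [h.policy_eq ht, ← mul_assoc]
    rw [h.integral_weighted_loss ht (g := fun s x a => R.policyAt s x a *
      (R.gapVec ρ s ⬝ᵥ R.precAt s *ᵥ R.φ a x))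
      (fun a => (h.measurable_policyAt a).mul (hgm a))
      (fun a => ((isBdd_of_mem_stdSimplex (p := fun p : Ω × 𝒳 => R.policyAt (R.param t p.1) p.2)
        (fun p => h.policyAt_mem t p.1 p.2) a).mul ⟨C a, hC a⟩))]
    simp_rw [h.integral_policyAt_mul]
  · intro a
    exact Measurable.mul ((h.measurable_param_context ht (hgm a)).mono le_sup_left le_rfl)
      (h.measurable_loss_arm ht a)
  · intro a
    filter_upwards [h.bounded.loss_le t ht] with ω hω
    rw [abs_mul]
    calc _ ≤ C a * 1 := mul_le_mul (hC a (ω, R.X t ω)) (hω a _) (abs_nonneg _)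
          ((abs_nonneg _).trans (hC a (ω, R.X t ω)))
      _ ≤ |C a| := by rw [mul_one]; exact le_abs_self _
      _ ≤ _ := Finset.single_le_sum (f := fun a => |C a|) (fun _ _ => abs_nonneg _)
        (Finset.mem_univ a)

/-- The stability term of a round is integrable, and its mean is at most a multiple of the mean
learning rate. -/
lemma integral_stability_le {t : ℕ} (ht : t < T) :
    Integrable (fun ω => 1 / R.invEta ω t *
        ∫ x, ∑ a, R.q t ω x a * R.lossHat t ω x a ^ 2 ∂ R.G) μ ∧
      ∫ ω, 1 / R.invEta ω t * ∫ x, ∑ a, R.q t ω x a * R.lossHat t ω x a ^ 2 ∂ R.G ∂μ ≤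
        ∫ ω, (1 / R.lam + d) * (1 / R.invEta ω t) ∂μ := by
  have hGp := h.model.isProbabilityMeasure
  have hfm := h.measurable_quadForm_secondMoment
  have hfb := h.isBdd_quadForm_secondMoment ht
  have hbm := (h.measurable_invEta ht)
  set F : Fin K → Ω → ℝ := fun a ω => 1 / (R.param t ω).2.1 *
    (R.φ a (R.X t ω) ⬝ᵥ R.secondMoment (R.param t ω) *ᵥ R.φ a (R.X t ω)) with hF
  choose C hC using hfb
  have hFc : ∀ a ω, |F a ω| ≤ ∑ a, |C a| := fun a ω =>
    (hC a (ω, R.X t ω)).trans ((le_abs_self _).trans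
      (Finset.single_le_sum (f := fun a => |C a|) (fun _ _ => abs_nonneg _) (Finset.mem_univ a)))
  have hFA : Integrable (fun ω => F (R.A t ω) ω) μ := by
    refine IsBdd.integrable ⟨_, fun ω => hFc (R.A t ω) ω⟩ ?_
    have h1 := measurable_from_prod_countable_right
      (f := fun p : Fin K × (((Fin d → ℝ) × ℝ × (Fin d → ℝ)) × 𝒳) =>
        1 / p.2.1.2.1 * (R.φ p.1 p.2.2 ⬝ᵥ R.secondMoment p.2.1 *ᵥ R.φ p.1 p.2.2)) hfm
    exact h1.comp ((h.measurable_action ht).prodMk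
      ((h.measurable_param' ht).prodMk (h.measurable_context ht)))
  -- The squared loss is bounded by one before averaging, so what remains depends on state, context
  -- and action but not on the noise.
  have hle : ∀ᵐ ω ∂μ, 1 / R.invEta ω t *
      ∫ x, ∑ a, R.q t ω x a * R.lossHat t ω x a ^ 2 ∂ R.G ≤ F (R.A t ω) ω := by
    filter_upwards [h.bounded.loss_le t ht] with ω hω
    have h1 := h.secondMoment_nonneg t ω (R.φ (R.A t ω) (R.X t ω))
    have h2 : R.loss t ω (R.A t ω) (R.X t ω) ^ 2 ≤ 1 := (sq_le_one_iff_abs_le_one _).2 (hω _ _)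
    rw [h.integral_iterate_lossHat_sq ht]
    exact mul_le_mul_of_nonneg_left (mul_le_of_le_one_left h1 h2)
      (one_div_pos.2 (h.invEta_pos ω t)).le
  have hnn : ∀ ω, 0 ≤ 1 / R.invEta ω t *
      ∫ x, ∑ a, R.q t ω x a * R.lossHat t ω x a ^ 2 ∂ R.G := fun ω =>
    mul_nonneg (one_div_pos.2 (h.invEta_pos ω t)).le (integral_nonneg fun x =>
      Finset.sum_nonneg fun a _ => mul_nonneg ((h.q_mem ht ω x).1 a) (sq_nonneg _))
  have hint : Integrable (fun ω => 1 / R.invEta ω t *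
        ∫ x, ∑ a, R.q t ω x a * R.lossHat t ω x a ^ 2 ∂ R.G) μ := by
    refine hFA.mono' (Measurable.aestronglyMeasurable ?_) ?_
    · have e1 : ∀ ω, ∫ x, ∑ a, R.q t ω x a * R.lossHat t ω x a ^ 2 ∂ R.G =
          ∑ i, R.thetaHat t ω i * ∑ j, covMatrix R.G R.φ (R.iterateAt (R.param t ω)) i j *
            R.thetaHat t ω j := by
        intro ω
        rw [h.integral_iterate_lossHat_sq ht, h.dotProduct_secondMoment]
        change _ = R.thetaHat t ω ⬝ᵥ
          covMatrix R.G R.φ (R.iterateAt (R.param t ω)) *ᵥ R.thetaHat t ω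
        rw [h.thetaHat_eq_smul ht]
        simp only [mulVec_smul, dotProduct_smul, smul_dotProduct, smul_eq_mul]
        ring
      simp_rw [e1]
      have h1 := measurable_pi_iff.1 (h.measurable_thetaHat ht)
      have h2 : ∀ i j, Measurable fun ω => covMatrix R.G R.φ (R.iterateAt (R.param t ω)) i j :=
        fun i j => (h.measurable_covMatrix_iterateAt i j).comp (h.measurable_param' ht)
      fun_prop
    · filter_upwards [hle] with ω hω
      rwa [Real.norm_of_nonneg (hnn ω)]
  refine ⟨hint, (integral_mono_ae hint hFA hle).trans ?_⟩
  rw [h.integral_action ht (f := F) (c := ∑ a, |C a|)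
    (fun a => (h.measurable_param_context ht (hfm a)).mono le_sup_left le_rfl)
    (fun a => Filter.Eventually.of_forall (hFc a))]
  simp_rw [h.policy_eq ht]
  have hb2 : IsBdd fun p : Ω × 𝒳 => ∑ a, R.policyAt (R.param t p.1) p.2 a *
      (1 / (R.param t p.1).2.1 *
        (R.φ a p.2 ⬝ᵥ R.secondMoment (R.param t p.1) *ᵥ R.φ a p.2)) :=
    IsBdd.sum fun a _ => (isBdd_of_mem_stdSimplex
      (p := fun p : Ω × 𝒳 => R.policyAt (R.param t p.1) p.2)
      (fun p => h.policyAt_mem t p.1 p.2) a).mul ⟨C a, hC a⟩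
  have hm2 : Measurable fun p : ((Fin d → ℝ) × ℝ × (Fin d → ℝ)) × 𝒳 =>
      ∑ a, R.policyAt p.1 p.2 a *
        (1 / p.1.2.1 * (R.φ a p.2 ⬝ᵥ R.secondMoment p.1 *ᵥ R.φ a p.2)) :=
    Finset.measurable_sum _ fun a _ => (h.measurable_policyAt a).mul (hfm a)
  refine (h.integral_context ht (h.measurable_param ht) hm2 hb2).le.trans ?_
  refine integral_mono_of_nonneg (Filter.Eventually.of_forall fun ω => ?_)
    (((h.isBdd_one_div_invEta t).integrable (by fun_prop)).const_mul _)
    (Filter.Eventually.of_forall fun ω => ?_)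
  · exact integral_nonneg fun x => Finset.sum_nonneg fun a _ =>
      mul_nonneg ((h.policyAt_mem t ω x).1 a) (mul_nonneg
        (one_div_pos.2 (h.invEta_pos ω t)).le (h.secondMoment_nonneg t ω _))
  · have e2 : ∀ x, ∑ a, R.policyAt (R.param t ω) x a * (1 / (R.param t ω).2.1 *
        (R.φ a x ⬝ᵥ R.secondMoment (R.param t ω) *ᵥ R.φ a x)) = 1 / R.invEta ω t *
        ∑ a, R.policyAt (R.param t ω) x a *
          (R.φ a x ⬝ᵥ R.secondMoment (R.param t ω) *ᵥ R.φ a x) := by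
      intro x
      rw [Finset.mul_sum]
      exact Finset.sum_congr rfl fun a _ => mul_left_comm _ _ _
    simp only [e2]
    rw [integral_const_mul, mul_comm]
    exact mul_le_mul_of_nonneg_right (h.integral_secondMoment_le t ω)
      (one_div_pos.2 (h.invEta_pos ω t)).le

end Moments

end IsSetting

end Run

namespace Run

open Matrix

variable {K d T : ℕ} {𝒳 Ω : Type*} [MeasurableSpace 𝒳] {R : Run K d T 𝒳 Ω}

namespace IsSetting

variable [mΩ : MeasurableSpace Ω] {μ : Measure Ω} {ℱ : Filtration ℕ mΩ}
  {Z Θ : Set (Fin d → ℝ)} (h : R.IsSetting μ ℱ Z Θ)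

include h

/-! ### FTRL along a fixed outcome. -/

section Pathwise

lemma measurable_lossHat (t : ℕ) (ω : Ω) (a : Fin K) : Measurable fun x => R.lossHat t ω x a := by
  have := h.measurable_feature_pi a
  unfold lossHat dotProduct
  fun_prop

lemma isBdd_lossHat (t : ℕ) (ω : Ω) (a : Fin K) : IsBdd fun x => R.lossHat t ω x a := by
  unfold lossHat dotProduct
  exact IsBdd.sum fun i _ => (IsBdd.const _).mul (h.isBdd_feature a i)

lemma measurable_q {t : ℕ} (ht : t < T) (ω : Ω) (a : Fin K) :
    Measurable fun x => R.q t ω x a := by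
  simp_rw [h.q_eq ht]
  exact h.measurable_iterateAt_right _ a

lemma isBdd_entropy_q {t : ℕ} (ht : t < T) :
    IsBdd fun p : Ω × 𝒳 => entropy (R.q t p.1 p.2) :=
  IsBdd.of_mem_Icc fun p => ⟨entropy_nonneg (h.q_mem ht p.1 p.2),
    entropy_le_log h.arms_pos (h.q_mem ht p.1 p.2)⟩

lemma measurable_entropy_q {t : ℕ} (ht : t < T) (ω : Ω) :
    Measurable fun x => entropy (R.q t ω x) := by
  have := h.measurable_q ht ω
  unfold entropy
  fun_prop

lemma gapVec_dotProduct_thetaHat {ρ : 𝒳 → Fin K} (hρ : Measurable ρ) {t : ℕ} (ht : t < T)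
    (ω : Ω) : R.gapVec ρ (R.param t ω) ⬝ᵥ R.thetaHat t ω =
      ∫ x, (∑ a, R.q t ω x a * R.lossHat t ω x a - R.lossHat t ω x (ρ x)) ∂ R.G := by
  rw [h.gapVec_dotProduct hρ]
  congr 1
  funext x
  simp only [sub_mul, Finset.sum_sub_distrib, ite_mul, one_mul, zero_mul, Finset.sum_ite_eq,
    Finset.mem_univ, if_true, lossHat, dotProduct_comm (R.thetaHat t ω), h.q_eq ht]

/-- The estimated linear regret, averaged over the contexts. -/
lemma sum_gapVec_dotProduct_le {n : ℕ} (hn : T = n + 1) {ρ : 𝒳 → Fin K} (hρ : Measurable ρ)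
    {ω : Ω} (hω : ∀ t < T, ∀ a x, |R.loss t ω a x| ≤ 1) :
    ∑ t ∈ Finset.range (n + 1), R.gapVec ρ (R.param t ω) ⬝ᵥ R.thetaHat t ω ≤
      R.invEtaFirst * Real.log K + ∑ t ∈ Finset.range n, (R.invEta ω (t + 1) - R.invEta ω t) *
          ∫ x, entropy (R.q (t + 1) ω x) ∂ R.G +
        ∑ t ∈ Finset.range (n + 1), 1 / R.invEta ω t *
          ∫ x, ∑ a, R.q t ω x a * R.lossHat t ω x a ^ 2 ∂ R.G := by
  have := h.model.isProbabilityMeasure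
  have hlt : ∀ t ∈ Finset.range (n + 1), t < T := fun t ht => hn ▸ Finset.mem_range.1 ht
  have hlt' : ∀ t ∈ Finset.range n, t + 1 < T := fun t ht => by
    have := Finset.mem_range.1 ht
    omega
  -- FTRL at a frozen context `x` against the fixed arm `ρ x`; no context varies with the round, and
  -- `x` is integrated out afterwards.
  have hpt : ∀ x, ∑ t ∈ Finset.range (n + 1),
      (∑ a, R.q t ω x a * R.lossHat t ω x a - R.lossHat t ω x (ρ x)) ≤
      R.invEtaFirst * Real.log K + ∑ t ∈ Finset.range n, (R.invEta ω (t + 1) - R.invEta ω t) *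
          entropy (R.q (t + 1) ω x) +
        ∑ t ∈ Finset.range (n + 1), 1 / R.invEta ω t *
          ∑ a, R.q t ω x a * R.lossHat t ω x a ^ 2 := by
    intro x
    refine ftrl_regret_le h.arms_pos (R.invEta ω) (h.invEta_pos ω)
      (fun t a => R.lossHat t ω x a) n ?_ (fun t => R.q t ω x) ?_ (ρ x)
    · intro t ht a
      have ht' : t < T := by omega
      rw [lossHat, h.thetaHat_eq_smul ht', smul_dotProduct, smul_eq_mul, abs_mul, dotProduct_comm]
      exact (mul_le_of_le_one_left (abs_nonneg _) (hω t ht' _ _)).trans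
        (h.abs_precAt_feature_le t ω _ _ _ _)
    · intro t ht
      funext a
      rw [h.q_eq (by omega), iterateAt]
      congr 1
      funext b
      simp [param, cumTheta, lossHat, sum_dotProduct]
  have i1 : ∀ t ∈ Finset.range (n + 1), Integrable (fun x =>
      ∑ a, R.q t ω x a * R.lossHat t ω x a - R.lossHat t ω x (ρ x)) R.G := by
    intro t ht
    have e1 : ∀ x, R.lossHat t ω x (ρ x) = ∑ a, (if ρ x = a then 1 else 0) * R.lossHat t ω x a := by
      intro x
      simp
    simp_rw [e1]
    refine IsBdd.integrable ((IsBdd.sum fun a _ =>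
      (isBdd_of_mem_stdSimplex (h.q_mem (hlt t ht) ω) a).mul (h.isBdd_lossHat t ω a)).sub
      (IsBdd.sum fun a _ => (IsBdd.of_mem_Icc (a := 0) (b := 1) fun x => ?_).mul
        (h.isBdd_lossHat t ω a))) ?_
    · split_ifs <;> simp
    · exact (Finset.measurable_sum _ fun a _ =>
        (h.measurable_q (hlt t ht) ω a).mul (h.measurable_lossHat t ω a)).sub
        (Finset.measurable_sum _ fun a _ => (Measurable.ite
          (hρ (measurableSet_singleton a)) measurable_const measurable_const).mul
          (h.measurable_lossHat t ω a))
  have i2 : ∀ t ∈ Finset.range n, Integrable (fun x => (R.invEta ω (t + 1) - R.invEta ω t) *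
      entropy (R.q (t + 1) ω x)) R.G := fun t ht =>
    (((h.isBdd_entropy_q (hlt' t ht)).comp fun x => (ω, x)).integrable
      (h.measurable_entropy_q (hlt' t ht) ω)).const_mul _
  have i3 : ∀ t ∈ Finset.range (n + 1), Integrable (fun x => 1 / R.invEta ω t *
      ∑ a, R.q t ω x a * R.lossHat t ω x a ^ 2) R.G := by
    intro t ht
    refine Integrable.const_mul (IsBdd.integrable (IsBdd.sum fun a _ =>
      (isBdd_of_mem_stdSimplex (h.q_mem (hlt t ht) ω) a).mul ?_) ?_) _
    · simp_rw [sq]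
      exact (h.isBdd_lossHat t ω a).mul (h.isBdd_lossHat t ω a)
    · exact Finset.measurable_sum _ fun a _ => (h.measurable_q (hlt t ht) ω a).mul
        ((h.measurable_lossHat t ω a).pow_const 2)
  have hle := integral_mono (μ := R.G) (integrable_finsetSum _ i1)
    (((integrable_const (R.invEtaFirst * Real.log K)).add (integrable_finsetSum _ i2)).add
      (integrable_finsetSum _ i3)) hpt
  rw [integral_finsetSum _ i1] at hle
  have e2 := integral_add ((integrable_const (μ := R.G) (R.invEtaFirst * Real.log K)).add
    (integrable_finsetSum _ i2)) (integrable_finsetSum _ i3)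
  have e3 := integral_add (integrable_const (μ := R.G) (R.invEtaFirst * Real.log K))
    (integrable_finsetSum _ i2)
  simp only [Pi.add_apply] at e2 e3
  rw [e3, integral_finsetSum _ i2, integral_finsetSum _ i3] at e2
  simp only [integral_const_mul, integral_const, probReal_univ, one_smul] at e2
  rw [Finset.sum_congr rfl fun t ht => h.gapVec_dotProduct_thetaHat hρ (hlt t ht) ω]
  exact hle.trans e2.le

/-- The self-bounding estimate for the entropy-adaptive learning rates. -/
lemma sum_invEta_sub_mul_entropy_le {n : ℕ} (hn : T = n + 1) (ω : Ω) :
    ∑ t ∈ Finset.range n, (R.invEta ω (t + 1) - R.invEta ω t) *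
      entropy (R.q (t + 1) ω (R.X (t + 1) ω)) ≤ 2 * (R.invEtaFirst * Real.log K) * √(T : ℝ) := by
  have hK := h.log_arms_pos
  -- Dividing by `log K` puts the entropies in `[0, 1]` and matches the definition of `invEta`.
  have h1 := sum_div_sqrt_le (a := fun t => entropy (R.q t ω (R.X t ω)) / Real.log K) n
    (fun t ht => div_nonneg (entropy_nonneg (h.q_mem (by omega) _ _)) hK.le)
    (fun t ht => (div_le_one hK).2 (entropy_le_log h.arms_pos (h.q_mem (by omega) _ _)))
  have h2 := mul_le_mul_of_nonneg_left h1 (mul_pos h.invEtaFirst_pos hK).le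
  calc _ = R.invEtaFirst * Real.log K * ∑ t ∈ Finset.range n,
        entropy (R.q (t + 1) ω (R.X (t + 1) ω)) / Real.log K /
          √(1 + ∑ s ∈ Finset.range (t + 1), entropy (R.q s ω (R.X s ω)) / Real.log K) := by
        rw [Finset.mul_sum]
        refine Finset.sum_congr rfl fun t _ => ?_
        rw [invEta, ← Finset.sum_div, div_eq_inv_mul _ (Real.log K)]
        field_simp
        ring
    _ ≤ _ := h2
    _ = _ := by
        have e : (n : ℝ) + 1 = T := by rw [hn]; push_cast; rfl
        rw [e]
        ring

lemma sum_one_div_invEta_le (ω : Ω) :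
    ∑ t ∈ Finset.range T, 1 / R.invEta ω t ≤ 2 * √(T : ℝ) / R.invEtaFirst := by
  have h0 := h.invEtaFirst_pos
  calc ∑ t ∈ Finset.range T, 1 / R.invEta ω t
      ≤ ∑ t ∈ Finset.range T, 1 / √((t : ℝ) + 1) / R.invEtaFirst := by
        refine Finset.sum_le_sum fun t ht => ?_
        rw [div_div, mul_comm]
        exact one_div_le_one_div_of_le (mul_pos h0 (Real.sqrt_pos.2 (by positivity)))
          (h.le_invEta (Finset.mem_range.1 ht) ω)
    _ ≤ _ := by
        rw [← Finset.sum_div]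
        exact div_le_div_of_nonneg_right (sum_inv_sqrt_le T) h0.le

end Pathwise

/-! ### Assembling the regret bound. -/

section Regret

variable [IsProbabilityMeasure μ] {ρ : 𝒳 → Fin K}

lemma integrable_gapVec_dotProduct_thetaHat (hρ : Measurable ρ) {t : ℕ} (ht : t < T) :
    Integrable (fun ω => R.gapVec ρ (R.param t ω) ⬝ᵥ R.thetaHat t ω) μ := by
  choose C hC using h.isBdd_gapVec_precAt (ρ := ρ) ht
  refine Integrable.of_bound (C := ∑ a, |C a|) (Measurable.aestronglyMeasurable ?_) ?_
  · have h1 := measurable_pi_iff.1 ((h.measurable_gapVec hρ).comp (h.measurable_param' ht))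
    have h2 := measurable_pi_iff.1 (h.measurable_thetaHat ht)
    exact Finset.measurable_sum _ fun i _ => (h1 i).mul (h2 i)
  · filter_upwards [h.bounded.loss_le t ht] with ω hω
    rw [h.thetaHat_eq_smul ht, dotProduct_smul, smul_eq_mul, Real.norm_eq_abs, abs_mul]
    exact (mul_le_of_le_one_left (abs_nonneg _) (hω _ _)).trans ((hC _ (ω, R.X t ω)).trans
      ((le_abs_self _).trans (Finset.single_le_sum (f := fun a => |C a|)
        (fun _ _ => abs_nonneg _) (Finset.mem_univ _))))

lemma integrable_excess (hρ : Measurable ρ) {t : ℕ} (ht : t < T) :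
    Integrable (fun ω => R.loss t ω (R.A t ω) (R.X t ω)) μ ∧
      Integrable (fun ω => R.loss t ω (ρ (R.X t ω)) (R.X t ω)) μ := by
  constructor
  · refine Integrable.of_bound (h.measurable_loss ht).aestronglyMeasurable 1 ?_
    filter_upwards [h.bounded.loss_le t ht] with ω hω using hω _ _
  · have e1 : ∀ ω, R.loss t ω (ρ (R.X t ω)) (R.X t ω) =
        ∑ a, (if ρ (R.X t ω) = a then 1 else 0) * R.loss t ω a (R.X t ω) := by
      intro ω
      simp
    refine Integrable.of_bound (C := 1) (Measurable.aestronglyMeasurable ?_) ?_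
    · simp_rw [e1]
      exact Finset.measurable_sum _ fun a _ => (Measurable.ite
          ((hρ.comp (h.measurable_context ht)) (measurableSet_singleton a))
          measurable_const measurable_const).mul
          ((h.measurable_loss_arm ht a).mono (h.noise_le ht) le_rfl)
    · filter_upwards [h.bounded.loss_le t ht] with ω hω using hω _ _

/-- The expected excess loss of a round in terms of the estimated linear regret. -/
lemma integral_excess_le (hρ : Measurable ρ) {t : ℕ} (ht : t < T) :
    ∫ ω, (R.loss t ω (R.A t ω) (R.X t ω) - R.loss t ω (ρ (R.X t ω)) (R.X t ω)) ∂μ ≤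
      ∫ ω, R.gapVec ρ (R.param t ω) ⬝ᵥ R.thetaHat t ω ∂μ +
        2 / R.lam * ∫ ω, 1 / R.invEta ω t ∂μ := by
  have hGp := h.model.isProbabilityMeasure
  obtain ⟨i1, i2⟩ := h.integrable_excess hρ ht
  set g : ((Fin d → ℝ) × ℝ × (Fin d → ℝ)) → 𝒳 → Fin K → ℝ :=
    fun s x a => R.policyAt s x a - if ρ x = a then 1 else 0 with hg
  have hgm : ∀ a, Measurable fun p : ((Fin d → ℝ) × ℝ × (Fin d → ℝ)) × 𝒳 => g p.1 p.2 a :=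
    fun a => (h.measurable_policyAt a).sub (Measurable.ite
      ((hρ.comp measurable_snd) (measurableSet_singleton a)) measurable_const measurable_const)
  have hgb : ∀ a, IsBdd fun p : Ω × 𝒳 => g (R.param t p.1) p.2 a := by
    intro a
    refine (isBdd_of_mem_stdSimplex (p := fun p : Ω × 𝒳 => R.policyAt (R.param t p.1) p.2)
      (fun p => h.policyAt_mem t p.1 p.2) a).sub (IsBdd.of_mem_Icc (a := 0) (b := 1) fun p => ?_)
    split_ifs <;> simp
  have hφθ : ∀ a, Measurable fun p : ((Fin d → ℝ) × ℝ × (Fin d → ℝ)) × 𝒳 =>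
      R.φ a p.2 ⬝ᵥ p.1.2.2 := by
    intro a
    have := h.measurable_feature_pi a
    unfold dotProduct
    fun_prop
  have hbφ : ∀ a, IsBdd fun p : Ω × 𝒳 => R.φ a p.2 ⬝ᵥ R.θ t p.1 := fun a =>
    ⟨1, fun p => h.abs_feature_dotProduct_le ht p.1 a p.2⟩
  have e1 : ∫ ω, (R.loss t ω (R.A t ω) (R.X t ω) - R.loss t ω (ρ (R.X t ω)) (R.X t ω)) ∂μ =
      ∫ ω, ∑ a, g (R.param t ω) (R.X t ω) a * R.loss t ω a (R.X t ω) ∂μ := by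
    rw [integral_sub i1 i2, h.integral_action ht (f := fun a ω => R.loss t ω a (R.X t ω)) (c := 1)
      (h.measurable_loss_arm ht)
      (fun a => (h.bounded.loss_le t ht).mono fun ω hω => hω _ _), ← integral_sub ?_ i2]
    · congr 1
      funext ω
      simp [hg, h.policy_eq ht, sub_mul]
    · refine integrable_finsetSum _ fun a _ => (h.integrable_loss_arm ht a).bdd_mul (c := 1) ?_
        (Filter.Eventually.of_forall fun ω => h.abs_policy_le_one ht ω _ a)
      simp_rw [h.policy_eq ht]
      exact (measurable_comp_pair (h.measurable_policyAt a) (h.measurable_param' ht)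
        (h.measurable_context ht)).aestronglyMeasurable
  have hin : ∀ ω, ∫ x, ∑ a, g (R.param t ω) x a * (R.φ a x ⬝ᵥ R.θ t ω) ∂ R.G ≤
      R.gapVec ρ (R.param t ω) ⬝ᵥ R.θ t ω + 2 / R.lam * (1 / R.invEta ω t) := by
    intro ω
    have hg0 := h.gammaAt_pos t ω
    have hx : ∀ x, ∑ a, g (R.param t ω) x a * (R.φ a x ⬝ᵥ R.θ t ω) ≤
        ∑ a, (R.iterateAt (R.param t ω) x a - if ρ x = a then 1 else 0) *
          (R.φ a x ⬝ᵥ R.θ t ω) + 2 / R.lam * (1 / R.invEta ω t) := by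
      intro x
      have h1 : ∀ p ∈ stdSimplex ℝ (Fin K), |∑ a, p a * (R.φ a x ⬝ᵥ R.θ t ω)| ≤ 1 := by
        intro p hp
        calc |∑ a, p a * (R.φ a x ⬝ᵥ R.θ t ω)| ≤ ∑ a, |p a * (R.φ a x ⬝ᵥ R.θ t ω)| :=
              Finset.abs_sum_le_sum_abs _ _
          _ ≤ ∑ a, p a := Finset.sum_le_sum fun a _ => by
              rw [abs_mul, abs_of_nonneg (hp.1 a)]
              exact mul_le_of_le_one_right (hp.1 a) (h.abs_feature_dotProduct_le ht ω a x)
          _ = 1 := hp.2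
      have h2 := (abs_le.1 (h1 _ (h.exploration.mem_simplex x))).2
      have h3 := (abs_le.1 (h1 _ (h.iterateAt_mem (R.param t ω) x))).1
      have h4 : 2 / R.lam * (1 / R.invEta ω t) = R.gammaAt (R.param t ω) * 2 := by
        simp only [gammaAt, param]
        ring
      -- Since `π = q + γ (e - q)`, exploration costs `γ` times a difference of two averages in
      -- `[-1, 1]`, hence at most `2γ`.
      have h5 : ∑ a, g (R.param t ω) x a * (R.φ a x ⬝ᵥ R.θ t ω) =
          ∑ a, (R.iterateAt (R.param t ω) x a - if ρ x = a then 1 else 0) *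
          (R.φ a x ⬝ᵥ R.θ t ω) + R.gammaAt (R.param t ω) *
            (∑ a, R.e x a * (R.φ a x ⬝ᵥ R.θ t ω) -
              ∑ a, R.iterateAt (R.param t ω) x a * (R.φ a x ⬝ᵥ R.θ t ω)) := by
        rw [← Finset.sum_sub_distrib, Finset.mul_sum, ← Finset.sum_add_distrib]
        refine Finset.sum_congr rfl fun a _ => ?_
        simp only [hg, policyAt]
        ring
      rw [h5, h4]
      have := mul_le_mul_of_nonneg_left (show ∑ a, R.e x a * (R.φ a x ⬝ᵥ R.θ t ω) -
        ∑ a, R.iterateAt (R.param t ω) x a * (R.φ a x ⬝ᵥ R.θ t ω) ≤ 2 by linarith) hg0.le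
      linarith
    have hφm : ∀ a, Measurable fun x => R.φ a x ⬝ᵥ R.θ t ω := fun a =>
      measurable_comp_pair (hφθ a) (U := fun _ : 𝒳 => R.param t ω) (X := fun x => x)
        measurable_const measurable_id
    have j1 : Integrable (fun x => ∑ a, g (R.param t ω) x a * (R.φ a x ⬝ᵥ R.θ t ω)) R.G := by
      refine IsBdd.integrable (IsBdd.sum fun a _ => ((hgb a).comp fun x => (ω, x)).mul
        ((hbφ a).comp fun x => (ω, x))) (Finset.measurable_sum _ fun a _ => Measurable.mul ?_ (hφm a))
      exact measurable_comp_pair (hgm a) (U := fun _ : 𝒳 => R.param t ω) (X := fun x => x)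
        measurable_const measurable_id
    have j2 : Integrable (fun x => ∑ a, (R.iterateAt (R.param t ω) x a -
        if ρ x = a then 1 else 0) * (R.φ a x ⬝ᵥ R.θ t ω)) R.G := by
      refine IsBdd.integrable (IsBdd.sum fun a _ => ((h.isBdd_gap a).comp fun x =>
        (R.param t ω, x)).mul ((hbφ a).comp fun x => (ω, x)))
        (Finset.measurable_sum _ fun a _ => Measurable.mul ?_ (hφm a))
      exact measurable_comp_pair (h.measurable_gap hρ a) (U := fun _ : 𝒳 => R.param t ω)
        (X := fun x => x) measurable_const measurable_id
    refine (integral_mono j1 (j2.add (integrable_const _)) hx).trans ?_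
    rw [h.gapVec_dotProduct hρ]
    have := integral_add j2 (integrable_const (μ := R.G) (2 / R.lam * (1 / R.invEta ω t)))
    simp only [Pi.add_apply] at this ⊢
    rw [this, integral_const, probReal_univ, one_smul]
  have k1 : Integrable (fun ω => ∫ x, ∑ a, g (R.param t ω) x a *
      (R.φ a x ⬝ᵥ R.θ t ω) ∂ R.G) μ := by
    refine IsBdd.integrable (IsBdd.integral (f := fun ω x => ∑ a, g (R.param t ω) x a *
      (R.φ a x ⬝ᵥ R.θ t ω)) (IsBdd.sum fun a _ => (hgb a).mul (hbφ a))) ?_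
    have hm : Measurable fun p : ((Fin d → ℝ) × ℝ × (Fin d → ℝ)) × 𝒳 =>
        ∑ a, g p.1 p.2 a * (R.φ a p.2 ⬝ᵥ p.1.2.2) :=
      Finset.measurable_sum _ fun a _ => (hgm a).mul (hφθ a)
    exact (hm.stronglyMeasurable.integral_prod_right' (ν := R.G)).measurable.comp
      (h.measurable_param' ht)
  have k2 : Integrable (fun ω => R.gapVec ρ (R.param t ω) ⬝ᵥ R.θ t ω) μ := by
    refine IsBdd.integrable ?_ ?_
    · simp_rw [h.gapVec_dotProduct hρ]
      exact IsBdd.integral (f := fun ω x => ∑ a, (R.iterateAt (R.param t ω) x a -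
        if ρ x = a then 1 else 0) * (R.φ a x ⬝ᵥ R.θ t ω)) (IsBdd.sum fun a _ =>
          ((h.isBdd_gap a).comp fun p : Ω × 𝒳 => (R.param t p.1, p.2)).mul (hbφ a))
    · have h1 := measurable_pi_iff.1 ((h.measurable_gapVec hρ).comp (h.measurable_param' ht))
      have h2 : Measurable fun ω => R.θ t ω :=
        measurable_snd.comp (measurable_snd.comp (h.measurable_param' ht))
      exact Finset.measurable_sum _ fun i _ => (h1 i).mul (measurable_pi_iff.1 h2 i)
  have k3 : Integrable (fun ω => 2 / R.lam * (1 / R.invEta ω t)) μ := by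
    have := h.measurable_invEta ht
    exact ((h.isBdd_one_div_invEta t).integrable (by fun_prop)).const_mul _
  rw [e1, h.integral_weighted_loss ht hgm hgb]
  refine (integral_mono k1 (k2.add k3) hin).trans ?_
  have := integral_add k2 k3
  simp only [Pi.add_apply] at this ⊢
  rw [this, integral_const_mul, h.integral_thetaHat_dotProduct hρ ht]

/-- The entropy of the iterate at the fresh context has the same mean as its average over the
contexts. -/
lemma integral_penalty_eq {t : ℕ} (ht : t + 1 < T) :
    Integrable (fun ω => (R.invEta ω (t + 1) - R.invEta ω t) *
        ∫ x, entropy (R.q (t + 1) ω x) ∂ R.G) μ ∧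
      Integrable (fun ω => (R.invEta ω (t + 1) - R.invEta ω t) *
        entropy (R.q (t + 1) ω (R.X (t + 1) ω))) μ ∧
      ∫ ω, (R.invEta ω (t + 1) - R.invEta ω t) * ∫ x, entropy (R.q (t + 1) ω x) ∂ R.G ∂μ =
        ∫ ω, (R.invEta ω (t + 1) - R.invEta ω t) *
          entropy (R.q (t + 1) ω (R.X (t + 1) ω)) ∂μ := by
  have hGp := h.model.isProbabilityMeasure
  have ht' : t < T := by omega
  -- Both inverse rates are known before the context of round `t + 1` is drawn; this is what allows
  -- that context to replace the integrated one.
  have hU : Measurable[ℱ (t + 1)] fun ω => (R.invEta ω t, R.param (t + 1) ω) := by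
    have h1 := (h.measurable_param ht').mono (ℱ.mono (Nat.le_succ t)) le_rfl
    exact Measurable.prodMk (measurable_fst.comp (measurable_snd.comp h1)) (h.measurable_param ht)
  have hf : Measurable fun p : (ℝ × ((Fin d → ℝ) × ℝ × (Fin d → ℝ))) × 𝒳 =>
      (p.1.2.2.1 - p.1.1) * entropy (R.iterateAt p.1.2 p.2) := by
    have h1 := measurable_comp_pair h.measurable_entropy_iterateAt
      (U := fun p : (ℝ × ((Fin d → ℝ) × ℝ × (Fin d → ℝ))) × 𝒳 => p.1.2) (X := fun p => p.2)
      (by fun_prop) (by fun_prop)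
    exact Measurable.mul (by fun_prop) h1
  have hb : IsBdd fun p : Ω × 𝒳 => (R.invEta p.1 (t + 1) - R.invEta p.1 t) *
      entropy (R.iterateAt (R.param (t + 1) p.1) p.2) := by
    have h1 := h.isBdd_entropy_q ht
    simp_rw [h.q_eq ht] at h1
    exact (((h.isBdd_invEta ht).comp Prod.fst).sub ((h.isBdd_invEta ht').comp Prod.fst)).mul h1
  have hU' := hU.mono (ℱ.le (t + 1)) le_rfl
  simp_rw [h.q_eq ht, ← integral_const_mul]
  refine ⟨IsBdd.integrable (IsBdd.integral (f := fun ω x => (R.invEta ω (t + 1) - R.invEta ω t) *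
    entropy (R.iterateAt (R.param (t + 1) ω) x)) hb) ?_,
    IsBdd.integrable (hb.comp fun ω => (ω, R.X (t + 1) ω)) ?_, ?_⟩
  · exact (hf.stronglyMeasurable.integral_prod_right' (ν := R.G)).measurable.comp hU'
  · exact measurable_comp_pair hf hU' (h.measurable_context ht)
  · exact (h.integral_context ht hU hf hb).symm

/-- The regret bound in terms of the initial learning rate. -/
lemma regretAgainst_le (hρ : Measurable ρ) :
    R.regretAgainst μ ρ ≤ 3 * (R.invEtaFirst * Real.log K) * √(T : ℝ) +
      6 * (1 / R.lam + d) * √(T : ℝ) / R.invEtaFirst := by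
  obtain ⟨n, hn⟩ : ∃ n, T = n + 1 := ⟨T - 1, by have := h.two_le_rounds; omega⟩
  have hT1 : 1 ≤ √(T : ℝ) := by
    rw [Real.one_le_sqrt, hn]
    push_cast
    linarith [n.cast_nonneg (α := ℝ)]
  have hlt : ∀ t ∈ Finset.range T, t < T := fun t ht => Finset.mem_range.1 ht
  have hlt' : ∀ t ∈ Finset.range n, t + 1 < T := fun t ht => by
    have := Finset.mem_range.1 ht
    omega
  have i1 := fun t ht => h.integrable_gapVec_dotProduct_thetaHat hρ (hlt t ht)
  have i2 := fun t ht => (h.integral_penalty_eq (hlt' t ht)).1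
  have i3 := fun t ht => (h.integral_stability_le (hlt t ht)).1
  have i4 := fun t ht => (h.integral_penalty_eq (hlt' t ht)).2.1
  have i5 : ∀ t ∈ Finset.range T, Integrable (fun ω => 1 / R.invEta ω t) μ := fun t ht => by
    have := h.measurable_invEta (hlt t ht)
    exact (h.isBdd_one_div_invEta t).integrable (by fun_prop)
  set η := ∑ t ∈ Finset.range T, ∫ ω, 1 / R.invEta ω t ∂μ with hη
  have hηle : η ≤ 2 * √(T : ℝ) / R.invEtaFirst := by
    rw [hη, ← integral_finsetSum _ i5]
    refine (integral_mono (integrable_finsetSum _ i5) (integrable_const _)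
      h.sum_one_div_invEta_le).trans_eq ?_
    simp
  have hη0 : 0 ≤ η := Finset.sum_nonneg fun t _ => integral_nonneg fun ω =>
    (one_div_pos.2 (h.invEta_pos ω t)).le
  have hpen : ∑ t ∈ Finset.range n, ∫ ω, (R.invEta ω (t + 1) - R.invEta ω t) *
      ∫ x, entropy (R.q (t + 1) ω x) ∂ R.G ∂μ ≤ 2 * (R.invEtaFirst * Real.log K) * √(T : ℝ) := by
    rw [Finset.sum_congr rfl fun t ht => (h.integral_penalty_eq (hlt' t ht)).2.2,
      ← integral_finsetSum _ i4]
    refine (integral_mono (integrable_finsetSum _ i4) (integrable_const _)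
      (h.sum_invEta_sub_mul_entropy_le hn)).trans_eq ?_
    simp
  have hstab : ∑ t ∈ Finset.range T, ∫ ω, 1 / R.invEta ω t *
      ∫ x, ∑ a, R.q t ω x a * R.lossHat t ω x a ^ 2 ∂ R.G ∂μ ≤ (1 / R.lam + d) * η := by
    rw [hη, Finset.mul_sum]
    refine Finset.sum_le_sum fun t ht => ?_
    rw [← integral_const_mul]
    exact (h.integral_stability_le (hlt t ht)).2
  have hpath : ∫ ω, ∑ t ∈ Finset.range T, R.gapVec ρ (R.param t ω) ⬝ᵥ R.thetaHat t ω ∂μ ≤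
      R.invEtaFirst * Real.log K + ∑ t ∈ Finset.range n,
        ∫ ω, (R.invEta ω (t + 1) - R.invEta ω t) *
          ∫ x, entropy (R.q (t + 1) ω x) ∂ R.G ∂μ +
        ∑ t ∈ Finset.range T, ∫ ω, 1 / R.invEta ω t *
          ∫ x, ∑ a, R.q t ω x a * R.lossHat t ω x a ^ 2 ∂ R.G ∂μ := by
    have hae : ∀ᵐ ω ∂μ, ∀ t < T, ∀ a x, |R.loss t ω a x| ≤ 1 := by
      rw [ae_all_iff]
      intro t
      by_cases ht : t < T
      · exact (h.bounded.loss_le t ht).mono fun ω hω _ => hω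
      · exact Filter.Eventually.of_forall fun ω ht' => absurd ht' ht
    have hle := integral_mono_ae (integrable_finsetSum _ i1)
      (((integrable_const (R.invEtaFirst * Real.log K)).add (integrable_finsetSum _ i2)).add
        (integrable_finsetSum _ i3)) (hae.mono fun ω hω => by
          have := h.sum_gapVec_dotProduct_le hn hρ hω
          rw [← hn] at this
          exact this)
    have e2 := integral_add ((integrable_const (μ := μ) (R.invEtaFirst * Real.log K)).add
      (integrable_finsetSum _ i2)) (integrable_finsetSum _ i3)
    have e3 := integral_add (integrable_const (μ := μ) (R.invEtaFirst * Real.log K))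
      (integrable_finsetSum _ i2)
    simp only [Pi.add_apply] at e2 e3
    rw [e3, integral_finsetSum _ i2, integral_finsetSum _ i3, integral_const, probReal_univ,
      one_smul] at e2
    exact hle.trans e2.le
  have hreg : R.regretAgainst μ ρ ≤
      ∫ ω, ∑ t ∈ Finset.range T, R.gapVec ρ (R.param t ω) ⬝ᵥ R.thetaHat t ω ∂μ +
        2 / R.lam * η := by
    have i6 : ∀ t ∈ Finset.range T, Integrable (fun ω => R.loss t ω (R.A t ω) (R.X t ω) -
        R.loss t ω (ρ (R.X t ω)) (R.X t ω)) μ := fun t ht =>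
      (h.integrable_excess hρ (hlt t ht)).1.sub (h.integrable_excess hρ (hlt t ht)).2
    rw [regretAgainst, integral_finsetSum _ i6, integral_finsetSum _ i1, hη, Finset.mul_sum,
      ← Finset.sum_add_distrib]
    exact Finset.sum_le_sum fun t ht => h.integral_excess_le hρ (hlt t ht)
  have hb := mul_pos h.invEtaFirst_pos h.log_arms_pos
  have h1 : 2 / R.lam * η ≤ 2 * (1 / R.lam + d) * η := by
    refine mul_le_mul_of_nonneg_right ?_ hη0
    have : (0 : ℝ) ≤ d := d.cast_nonneg
    have e : 2 / R.lam = 2 * (1 / R.lam) := by ring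
    rw [e]
    linarith
  -- The factor 3 collects one share from stability and two from exploration.
  have h2 : 3 * (1 / R.lam + d) * η ≤ 6 * (1 / R.lam + d) * √(T : ℝ) / R.invEtaFirst := by
    have h3 := h.const_pos
    calc 3 * (1 / R.lam + d) * η ≤ 3 * (1 / R.lam + d) * (2 * √(T : ℝ) / R.invEtaFirst) :=
          mul_le_mul_of_nonneg_left hηle (by positivity)
      _ = _ := by ring
  -- The initial term `invEtaFirst * log K` is absorbed through `1 ≤ √T`, turning the 2 of the
  -- penalty into 3.
  nlinarith

/-- The regret bound in terms of the parameters of the problem. -/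
lemma regretAgainst_le_log (hρ : Measurable ρ) :
    R.regretAgainst μ ρ ≤
      30 * (Real.log ((K : ℝ) * T) * √((1 / R.lam + (d : ℝ)) * Real.log T * T)) := by
  have hM := h.const_pos
  have hk := h.log_arms_pos
  have hτ := h.log_rounds_pos
  have hβ := h.invEtaFirst_pos
  have hK2 : (2 : ℝ) ≤ K := by exact_mod_cast h.two_le_arms
  have hT2 : (2 : ℝ) ≤ T := by exact_mod_cast h.two_le_rounds
  have hl2 := Real.log_two_gt_d9
  have hk2 : Real.log 2 ≤ Real.log K := Real.log_le_log (by norm_num) hK2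
  have hτ2 : Real.log 2 ≤ Real.log T := Real.log_le_log (by norm_num) hT2
  refine (h.regretAgainst_le hρ).trans ?_
  rw [Real.log_mul (by linarith) (by linarith), Real.sqrt_mul (by positivity)]
  set M := 1 / R.lam + (d : ℝ)
  set k := Real.log K
  set τ := Real.log T
  have hb2 : R.invEtaFirst ^ 2 * k = M * τ := by
    change √(M * τ / k) ^ 2 * k = M * τ
    rw [Real.sq_sqrt (by positivity), div_mul_cancel₀ _ hk.ne']
  set b := R.invEtaFirst
  have hs2 : √(M * τ) ^ 2 = M * τ := Real.sq_sqrt (by positivity)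
  have hs : 0 < √(M * τ) := Real.sqrt_pos.2 (by positivity)
  set s := √(M * τ)
  -- After squaring this is `1 ≤ 4 k`, true because `k ≥ log 2`.
  have h1 : b * k ≤ 2 * (k * s) := by
    refine le_of_sq_le_sq ?_ (by positivity)
    have : b ^ 2 * k * k ≤ M * τ * (4 * k * k) := by
      rw [hb2]
      refine mul_le_mul_of_nonneg_left ?_ (by positivity)
      nlinarith
    calc (b * k) ^ 2 = b ^ 2 * k * k := by ring
      _ ≤ _ := this
      _ = _ := by rw [← hs2]; ring
  -- After squaring this is `1 ≤ 16 k τ²`, true because `k` and `τ` are at least `log 2`.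
  have h2 : M / b ≤ 4 * (k * s) := by
    rw [div_le_iff₀ hβ]
    refine le_of_sq_le_sq ?_ (by positivity)
    have e : (4 * (k * s) * b) ^ 2 = M ^ 2 * (16 * k * τ ^ 2) := by
      calc (4 * (k * s) * b) ^ 2 = 16 * k * s ^ 2 * (b ^ 2 * k) := by ring
        _ = _ := by rw [hs2, hb2]; ring
    rw [e]
    refine le_mul_of_one_le_right (by positivity) ?_
    have : 1 / 4 ≤ τ ^ 2 := by nlinarith
    nlinarith
  have hT0 : 0 ≤ √(T : ℝ) := Real.sqrt_nonneg _
  calc 3 * (b * k) * √(T : ℝ) + 6 * M * √(T : ℝ) / b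
      = (3 * (b * k) + 6 * (M / b)) * √(T : ℝ) := by ring
    -- `30 = 3 · 2 + 6 · 4`. The proof needs only `log K` here; the nonnegative `τ s` is added to
    -- reach `log (K T)`.
    _ ≤ (30 * ((k + τ) * s)) * √(T : ℝ) := by
        refine mul_le_mul_of_nonneg_right ?_ hT0
        have : 0 ≤ τ * s := by positivity
        linarith
    _ = _ := by ring

end Regret

end IsSetting

end Run

end LinBandit

end

/-- Regret bound for BoBW-RealFTRL in the adversarial regime, with an absolute constant `C`.
The hypothesis on `R.gamma 0` says that the mixing weight of the first round, the largest one,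
is at most one, so that the policies are probability vectors. The boundedness conjunct says that
the supremum which defines the regret is a genuine one. -/
theorem mainTheorem9 :
    ∃ C : ℝ, 0 < C ∧
      ∀ (K d T : ℕ) (𝒳 Ω : Type*) [MeasurableSpace 𝒳] [mΩ : MeasurableSpace Ω]
        (μ : MeasureTheory.Measure Ω) [MeasureTheory.IsProbabilityMeasure μ]
        (ℱ : MeasureTheory.Filtration ℕ mΩ) (Z Θ : Set (Fin d → ℝ))
        (R : LinBandit.Run K d T 𝒳 Ω),
        2 ≤ K → 2 ≤ T →
        LinBandit.IsContextModel R.G R.φ Z →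
        LinBandit.IsExplorationPolicy R.G R.φ Z R.lam R.e →
        R.IsBounded μ Z Θ →
        R.IsAdversarial μ ℱ Θ →
        R.IsBoBWRealFTRL →
        (∀ ω, R.gamma 0 ω ≤ 1) →
        BddAbove (Set.range fun ρ : {ρ : 𝒳 → Fin K // Measurable ρ} => R.regretAgainst μ ρ) ∧
        R.regret μ ≤
          C * (Real.log ((K : ℝ) * T) * √((1 / R.lam + (d : ℝ)) * Real.log T * T)) := by
  refine ⟨30, by norm_num, ?_⟩
  intro K d T 𝒳 Ω _ mΩ μ _ ℱ Z Θ R hK hT hmodel hexp hbdd hadv halg hγ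
  have h : R.IsSetting μ ℱ Z Θ := ⟨hK, hT, hmodel, hexp, hbdd, hadv, halg, hγ⟩
  have hle : ∀ ρ : {ρ : 𝒳 → Fin K // Measurable ρ}, R.regretAgainst μ ρ ≤
      30 * (Real.log ((K : ℝ) * T) * √((1 / R.lam + (d : ℝ)) * Real.log T * T)) :=
    fun ρ => h.regretAgainst_le_log ρ.2
  -- A real supremum is bounded by a common upper bound through `ciSup_le` only over a nonempty
  -- family; constant comparators provide one.
  have : Nonempty {ρ : 𝒳 → Fin K // Measurable ρ} :=
    ⟨⟨fun _ => ⟨0, h.arms_pos⟩, measurable_const⟩⟩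
  exact ⟨⟨_, Set.forall_mem_range.2 hle⟩, ciSup_le hle⟩
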